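/- Let $(\mathcal V,g)$ be a four-dimensional smooth spacetime (a smooth $4$-manifold with a smooth Lorentzian metric $g$), with Levi-Civita connection $\nabla$ (also denoted by a semicolon) and Riemann tensor $R_{\alpha\beta\lambda\mu}$. No field equations or conditions on the matter content are assumed. The Bel tensor is $$B_{\alpha\beta\lambda\mu}=R_{\alpha\rho\lambda\sigma}R_\beta{}^\rho{}_\mu{}^\sigma+R_{\alpha\rho\mu\sigma}R_\beta{}^\rho{}_\lambda{}^\sigma-\tfrac12 g_{\alpha\beta}R_{\rho\tau\lambda\sigma}R^{\rho\tau}{}_\mu{}^\sigma-\tfrac12 g_{\lambda\mu}R_{\alpha\rho\sigma\tau}R_\beta{}^{\rho\sigma\tau}+\tfrac18 g_{\alpha\beta}g_{\lambda\mu}R_{\rho\tau\sigma\nu}R^{\rho\tau\sigma\nu},$$ and the Bel current of three Killing vector fields $\xi_1,\xi_2,\xi_3$ is $j_\mu(\xi_1,\xi_2,\xi_3)=B_{(\alpha\beta\lambda)\mu}\,\xi_1^\alpha\xi_2^\beta\xi_3^\lambda$. Round and square brackets denote symmetrization and antisymmetrization. A vector field is non-null if none of its values is a non-zero null vector. (1)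 Let $\xi$ be a non-null Killing vector field that is integrable (hypersurface-orthogonal), i.e. $\xi_{[\alpha}\xi_{\beta;\gamma]}=0$. Then its Bel current is proportional to $\xi$ at every point: $j_{[\beta}(\xi,\xi,\xi)\,\xi_{\lambda]}=0$. (2) Let $\xi$ and $\eta$ be two independent (over $\mathbb R$) non-null Killing vector fields with $[\xi,\eta]=0$ whose group acts orthogonally transitively, i.e. $\xi_{[\alpha}\eta_\beta\eta_{\lambda;\rho]}=0$ and $\eta_{[\alpha}\xi_\beta\xi_{\lambda;\rho]}=0$. Put $\xi_1=\xi$, $\xi_2=\eta$. Then for all $L,M,N\in\{1,2\}$ the Bel current $j(\xi_L,\xi_M,\xi_N)$ satisfies $$j_{[\beta}(\xi_L,\xi_M,\xi_N)\,\xi_\lambda\eta_{\mu]}=0$$ everywhere; in particular, at every point where the vectors $\xi$ and $\eta$ are linearly independent, $j(\xi_L,\xi_M,\xi_N)$ lies in their span. -/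

import Mathlib

open scoped Manifold ContDiff

noncomputable section

namespace BelCurrents

/-- The model space `ℝ⁴` of a four-dimensional spacetime. -/
abbrev E4 : Type := EuclideanSpace ℝ (Fin 4)

/-- Indices of tensor components, running from `0` to `3`. -/
abbrev Idx : Type := Fin 4

section Spacetime

variable (V : Type*) [TopologicalSpace V] [ChartedSpace E4 V] [IsManifold (𝓡 4) ∞ V]

/-- A smooth Lorentzian metric on the four-dimensional manifold `V`: a smooth field of symmetric
bilinear forms on the tangent spaces, each having an orthonormal basis of Lorentzian signature.
Both sign conventions, `(-,+,+,+)` (with `s = 1`) and `(+,-,-,-)` (with `s = -1`), are allowed. -/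
structure LorentzMetric where
  /-- The bilinear form on each tangent space. -/
  val (p : V) : TangentSpace (𝓡 4) p →L[ℝ] TangentSpace (𝓡 4) p →L[ℝ] ℝ
  symm (p : V) (v w : TangentSpace (𝓡 4) p) : val p v w = val p w v
  lorentzian (p : V) : ∃ b : Module.Basis Idx ℝ (TangentSpace (𝓡 4) p), ∃ s : ℝ,
    (s = 1 ∨ s = -1) ∧
      ∀ i j, val p (b i) (b j) = if i = j then (if i = 0 then -s else s) else 0
  contMDiff : ContMDiff (𝓡 4) ((𝓡 4).prod 𝓘(ℝ, E4 →L[ℝ] E4 →L[ℝ] ℝ)) ∞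
    (fun p ↦ Bundle.TotalSpace.mk' (E4 →L[ℝ] E4 →L[ℝ] ℝ)
      (E := fun p : V ↦ TangentSpace (𝓡 4) p →L[ℝ] TangentSpace (𝓡 4) p →L[ℝ] ℝ) p (val p))

/-- A (not necessarily smooth) vector field on `V`. -/
abbrev VField : Type _ := (p : V) → TangentSpace (𝓡 4) p

end Spacetime

/-! ### Tensor calculus in coordinates

A metric on an open piece of `ℝ⁴` is given by its component functions `G i j`, and a covector field
by its component functions `w i`. -/

/-- The partial derivative `∂ᵢ f`. -/
def pd (i : Idx) (f : E4 → ℝ) (y : E4) : ℝ :=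
  fderiv ℝ f y (EuclideanSpace.single i 1)

/-- The contravariant metric components `g^{ij}` (the inverse matrix). -/
def metricInv (G : Idx → Idx → E4 → ℝ) (i j : Idx) (y : E4) : ℝ :=
  (Matrix.of fun a b ↦ G a b y)⁻¹ i j

/-- The Christoffel symbols `Γ^k_{ij}` of the Levi-Civita connection. -/
def christoffel (G : Idx → Idx → E4 → ℝ) (k i j : Idx) (y : E4) : ℝ :=
  (1 / 2) * ∑ l, metricInv G k l y * (pd i (G j l) y + pd j (G i l) y - pd l (G i j) y)

/-- The covariant derivative `w_{i;j} = ∂ⱼ wᵢ - Γ^k_{ij} w_k` of a covector field. -/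
def covDeriv (G : Idx → Idx → E4 → ℝ) (w : Idx → E4 → ℝ) (i j : Idx) (y : E4) : ℝ :=
  pd j (w i) y - ∑ k, christoffel G k i j y * w k y

/-- The curvature
`R^k_{lij} = ∂ᵢ Γ^k_{jl} - ∂ⱼ Γ^k_{il} + Γ^k_{im} Γ^m_{jl} - Γ^k_{jm} Γ^m_{il}`. -/
def riemannUp (G : Idx → Idx → E4 → ℝ) (k l i j : Idx) (y : E4) : ℝ :=
  pd i (christoffel G k j l) y - pd j (christoffel G k i l) y
    + ∑ m, (christoffel G k i m y * christoffel G m j l y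
      - christoffel G k j m y * christoffel G m i l y)

/-- The Riemann tensor `R_{klij} = g_{km} R^m_{lij}`. -/
def riemann (G : Idx → Idx → E4 → ℝ) (k l i j : Idx) (y : E4) : ℝ :=
  ∑ m, G k m y * riemannUp G m l i j y

/-- The algebraic expression of the Bel tensor `B_{αβλμ}` at one point, in terms of the metric `g`,
its inverse `h` and the curvature `R_{αβλμ}`. The primed indices are contracted with `h`. -/
def belOf (g h : Idx → Idx → ℝ) (R : Idx → Idx → Idx → Idx → ℝ) (α β l μ : Idx) : ℝ :=
  (∑ ρ, ∑ ρ', ∑ σ, ∑ σ', h ρ ρ' * h σ σ' * R α ρ l σ * R β ρ' μ σ')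
    + (∑ ρ, ∑ ρ', ∑ σ, ∑ σ', h ρ ρ' * h σ σ' * R α ρ μ σ * R β ρ' l σ')
    - (1 / 2) * g α β * (∑ ρ, ∑ ρ', ∑ τ, ∑ τ', ∑ σ, ∑ σ',
        h ρ ρ' * h τ τ' * h σ σ' * R ρ τ l σ * R ρ' τ' μ σ')
    - (1 / 2) * g l μ * (∑ ρ, ∑ ρ', ∑ σ, ∑ σ', ∑ τ, ∑ τ',
        h ρ ρ' * h σ σ' * h τ τ' * R α ρ σ τ * R β ρ' σ' τ')
    + (1 / 8) * g α β * g l μ * (∑ ρ, ∑ ρ', ∑ τ, ∑ τ', ∑ σ, ∑ σ', ∑ ν, ∑ ν',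
        h ρ ρ' * h τ τ' * h σ σ' * h ν ν' * R ρ τ σ ν * R ρ' τ' σ' ν')

/-- The Bel tensor `B_{αβλμ}` of a metric. -/
def bel (G : Idx → Idx → E4 → ℝ) (α β l μ : Idx) (y : E4) : ℝ :=
  belOf (fun i j ↦ G i j y) (fun i j ↦ metricInv G i j y) (fun a b c d ↦ riemann G a b c d y)
    α β l μ

/-- Symmetrization `T_{(a₁ … aₙ)}`, with the factor `1 / n!`. -/
def symz {n : ℕ} (T : (Fin n → Idx) → ℝ) (a : Fin n → Idx) : ℝ :=
  (1 / (n.factorial : ℝ)) * ∑ s : Equiv.Perm (Fin n), T (a ∘ s)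

/-- Antisymmetrization `T_{[a₁ … aₙ]}`, with the factor `1 / n!`. -/
def antisymz {n : ℕ} (T : (Fin n → Idx) → ℝ) (a : Fin n → Idx) : ℝ :=
  (1 / (n.factorial : ℝ)) *
    ∑ s : Equiv.Perm (Fin n), ((Equiv.Perm.sign s : ℤ) : ℝ) * T (a ∘ s)

/-! ### Components in a chart -/

section Chart

variable {V : Type*} [TopologicalSpace V] [ChartedSpace E4 V] [IsManifold (𝓡 4) ∞ V]

/-- The coordinate vector `∂ᵢ` of the chart `e`, at the point with coordinates `y`. -/
def coordVec (e : OpenPartialHomeomorph V E4) (y : E4) (i : Idx) :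
    TangentSpace (𝓡 4) (e.symm y) :=
  mfderiv 𝓘(ℝ, E4) (𝓡 4) e.symm y (EuclideanSpace.single i (1 : ℝ) : E4)

/-- The metric components `g_{ij} = g(∂ᵢ, ∂ⱼ)` in the chart `e`. -/
def metricComp (g : LorentzMetric V) (e : OpenPartialHomeomorph V E4) (i j : Idx) (y : E4) : ℝ :=
  g.val (e.symm y) (coordVec e y i) (coordVec e y j)

/-- The contravariant components `v^i = dx^i(v)` of a vector field in the chart `e`. -/
def upperComp (v : VField V) (e : OpenPartialHomeomorph V E4) (i : Idx) (y : E4) : ℝ :=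
  (EuclideanSpace.proj i : E4 →L[ℝ] ℝ)
    (mfderiv (𝓡 4) 𝓘(ℝ, E4) e (e.symm y) (v (e.symm y)))

/-- The covariant components `v_i = g(v, ∂ᵢ)` of a vector field in the chart `e`. -/
def lowerComp (g : LorentzMetric V) (v : VField V) (e : OpenPartialHomeomorph V E4) (i : Idx)
    (y : E4) : ℝ :=
  g.val (e.symm y) (v (e.symm y)) (coordVec e y i)

/-- The covariant derivative `v_{i;j}` of a vector field in the chart `e`. -/
def nabla (g : LorentzMetric V) (v : VField V) (e : OpenPartialHomeomorph V E4) (i j : Idx)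
    (y : E4) : ℝ :=
  covDeriv (metricComp g e) (lowerComp g v e) i j y

/-- The Bel current `j_μ(ξ₁, ξ₂, ξ₃) = B_{(αβλ)μ} ξ₁^α ξ₂^β ξ₃^λ` in the chart `e`. -/
def belCurrent (g : LorentzMetric V) (ξ₁ ξ₂ ξ₃ : VField V) (e : OpenPartialHomeomorph V E4)
    (μ : Idx) (y : E4) : ℝ :=
  ∑ α, ∑ β, ∑ l,
    symz (fun a : Fin 3 → Idx ↦ bel (metricComp g e) (a 0) (a 1) (a 2) μ y) ![α, β, l]
      * upperComp ξ₁ e α y * upperComp ξ₂ e β y * upperComp ξ₃ e l y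

/-! ### Properties of vector fields

A tensor equation holds if its components vanish at all points of all charts of the smooth
structure. -/

/-- Smooth vector fields. -/
def IsSmooth (v : VField V) : Prop :=
  ContMDiff (𝓡 4) (𝓡 4).tangent ∞ (fun p ↦ (⟨p, v p⟩ : TangentBundle (𝓡 4) V))

/-- Killing vector fields: smooth with `v_{(i;j)} = 0`. -/
def IsKilling (g : LorentzMetric V) (v : VField V) : Prop :=
  IsSmooth v ∧ ∀ e ∈ IsManifold.maximalAtlas (𝓡 4) ∞ V, ∀ y ∈ e.target, ∀ a : Fin 2 → Idx,
    symz (fun b : Fin 2 → Idx ↦ nabla g v e (b 0) (b 1) y) a = 0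

/-- Non-null vector fields: no value of `v` is a (non-zero) null vector. -/
def IsNonNull (g : LorentzMetric V) (v : VField V) : Prop :=
  ∀ p : V, v p ≠ 0 → g.val p (v p) (v p) ≠ 0

/-- Integrable (hypersurface-orthogonal) vector fields: `v_{[α} v_{β;γ]} = 0`. -/
def IsHypersurfaceOrthogonal (g : LorentzMetric V) (v : VField V) : Prop :=
  ∀ e ∈ IsManifold.maximalAtlas (𝓡 4) ∞ V, ∀ y ∈ e.target, ∀ a : Fin 3 → Idx,
    antisymz (fun b : Fin 3 → Idx ↦
      lowerComp g v e (b 0) y * nabla g v e (b 1) (b 2) y) a = 0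

/-- The group generated by `v` and `w` acts orthogonally transitively:
`v_{[α} w_β w_{λ;ρ]} = 0` and `w_{[α} v_β v_{λ;ρ]} = 0`. -/
def IsOrthogonallyTransitive (g : LorentzMetric V) (v w : VField V) : Prop :=
  ∀ e ∈ IsManifold.maximalAtlas (𝓡 4) ∞ V, ∀ y ∈ e.target, ∀ a : Fin 4 → Idx,
    antisymz (fun b : Fin 4 → Idx ↦ lowerComp g v e (b 0) y * lowerComp g w e (b 1) y *
      nabla g w e (b 2) (b 3) y) a = 0 ∧
    antisymz (fun b : Fin 4 → Idx ↦ lowerComp g w e (b 0) y * lowerComp g v e (b 1) y *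
      nabla g v e (b 2) (b 3) y) a = 0

end Chart

end BelCurrents

end

/-!
The Bel current `j(ξ₁, ξ₂, ξ₃)` is orthogonal to a vector `X` if `B(ξ_σ(1), ξ_σ(2), ξ_σ(3), X) = 0`
for all permutations `σ`. So both parts amount to the vanishing of the Bel tensor at one point on
three vectors of a subspace `P` (spanned by the Killing vectors) and one vector of its orthogonal
complement.

If `P` is nondegenerate, consider the reflection that is the identity on `P` and `-1` on the
orthogonal complement. If the curvature is invariant under it, then so is the Bel tensor, which
therefore vanishes on three vectors of `P` and one orthogonal to it
(`belForm_eq_zero_of_reflection`). Invariance means that the curvature components with an odd number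
of arguments in `P` vanish. This follows by differentiating the hypotheses. A Killing field
satisfies `ξ_{i;jk} = -R_{akij} ξ^a` (`covDerivTwo_of_killing`), so the derivative of
`ξ_{[α} ξ_{β;γ]} = 0`, or of `ξ_{[α} η_β ξ_{λ;ρ]} = 0` and its counterpart for `η`, expresses the
components of `R(ξ, W)` and `R(η, W)` on vectors orthogonal to `P` (`deriv_hypersurfaceOrthogonal`,
`deriv_wedgeForm`), and the derivative of `∇_ξ η = ∇_η ξ` expresses `R(ξ, η)` by `∇ξ` and `∇η`
(`quadForm_of_comm`).

Although `ξ` and `η` are non-null, the plane `P` that they span may be degenerate, tangent to the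
light cone along a null vector `k`. No reflection is available there. The same differentiated
conditions, now used also in directions transversal to `P + P^⊥`, determine enough curvature
components in a null frame `ξ, k, f, l` with `P^⊥` spanned by `k` and `f`
(`IsOrbitData.isNullOrbitCurvature`), among them the Ricci component `R_{ξf} = 0`, and the
contractions in the Bel tensor are evaluated directly in that frame (`belForm_nullFrame`).

Where `ξ` and `η` are linearly dependent, `ξ_{[λ} η_{μ]} = 0` and there is nothing to prove.

Covariant derivatives at a point are taken as derivatives along a coordinate line of contractions
with vector fields that are parallel to first order there (`HasCovDerivAlong`).
-/

noncomputable section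

namespace BelCurrents

/-! ### Components in a chart -/

section ChartBridge

variable {V : Type*} [TopologicalSpace V] [ChartedSpace E4 V]

lemma mdifferentiable_of_mem_maximalAtlas {e : OpenPartialHomeomorph V E4}
    (he : e ∈ IsManifold.maximalAtlas (𝓡 4) ∞ V) : e.MDifferentiable (𝓡 4) 𝓘(ℝ, E4) :=
  ⟨(contMDiffOn_of_mem_maximalAtlas he).mdifferentiableOn (by simp),
    (contMDiffOn_symm_of_mem_maximalAtlas he).mdifferentiableOn (by simp)⟩

lemma mfderiv_symm_mfderiv {e : OpenPartialHomeomorph V E4}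
    (he : e ∈ IsManifold.maximalAtlas (𝓡 4) ∞ V) {y : E4} (hy : y ∈ e.target)
    (v : TangentSpace (𝓡 4) (e.symm y)) :
    mfderiv 𝓘(ℝ, E4) (𝓡 4) e.symm y (mfderiv (𝓡 4) 𝓘(ℝ, E4) e (e.symm y) v) = v := by
  have h := (mdifferentiable_of_mem_maximalAtlas he).symm_comp_deriv (e.map_target hy)
  rw [e.right_inv hy] at h
  exact congrArg (fun L ↦ L v) h

lemma mfderiv_mfderiv_symm {e : OpenPartialHomeomorph V E4}
    (he : e ∈ IsManifold.maximalAtlas (𝓡 4) ∞ V) {y : E4} (hy : y ∈ e.target) (v : E4) :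
    mfderiv (𝓡 4) 𝓘(ℝ, E4) e (e.symm y) (mfderiv 𝓘(ℝ, E4) (𝓡 4) e.symm y v) = v := by
  have h := (mdifferentiable_of_mem_maximalAtlas he).comp_symm_deriv hy
  exact congrArg (fun L ↦ L v) h

lemma eq_sum_single (x : E4) : x = ∑ i, x i • EuclideanSpace.single i (1 : ℝ) := by
  ext j
  simp [Finset.sum_apply, Pi.single_apply]

/-- The expansion `v = v^i ∂ᵢ` of a vector field in a chart. -/
lemma eq_sum_upperComp_smul_coordVec {e : OpenPartialHomeomorph V E4}
    (he : e ∈ IsManifold.maximalAtlas (𝓡 4) ∞ V) {y : E4} (hy : y ∈ e.target) (v : VField V) :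
    v (e.symm y) = ∑ i, upperComp v e i y • coordVec e y i := by
  have h := mfderiv_symm_mfderiv he hy (v (e.symm y))
  set x : E4 := mfderiv (𝓡 4) 𝓘(ℝ, E4) e (e.symm y) (v (e.symm y)) with hx
  have hx' := eq_sum_single x
  rw [← h]
  conv_lhs => rw [hx']
  exact map_sum (mfderiv 𝓘(ℝ, E4) (𝓡 4) e.symm y) _ _ |>.trans
    (Finset.sum_congr rfl fun i _ ↦ map_smul (mfderiv 𝓘(ℝ, E4) (𝓡 4) e.symm y) _ _)

variable [IsManifold (𝓡 4) ∞ V]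

/-- Lowering the index of a vector field. -/
lemma lowerComp_eq_sum {e : OpenPartialHomeomorph V E4}
    (he : e ∈ IsManifold.maximalAtlas (𝓡 4) ∞ V) {y : E4} (hy : y ∈ e.target)
    (g : LorentzMetric V) (v : VField V) (i : Idx) :
    lowerComp g v e i y = ∑ j, metricComp g e i j y * upperComp v e j y := by
  rw [lowerComp, g.symm, eq_sum_upperComp_smul_coordVec he hy v, map_sum]
  refine Finset.sum_congr rfl fun j _ ↦ ?_
  rw [map_smul, smul_eq_mul, mul_comm]
  rfl

lemma metricComp_symm (g : LorentzMetric V) (e : OpenPartialHomeomorph V E4) (i j : Idx) (y : E4) :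
    metricComp g e i j y = metricComp g e j i y :=
  g.symm _ _ _

lemma LorentzMetric.nondegenerate (g : LorentzMetric V) (p : V) (v : TangentSpace (𝓡 4) p)
    (h : ∀ w, g.val p v w = 0) : v = 0 := by
  obtain ⟨b, s, hs, hb⟩ := g.lorentzian p
  refine b.ext_elem fun i ↦ ?_
  have h1 := h (b i)
  rw [← b.sum_repr v] at h1
  simp only [map_sum, map_smul, sum_apply, smul_apply,
    smul_eq_mul, hb, mul_ite, mul_zero, Finset.sum_ite_eq', Finset.mem_univ, if_true] at h1
  rcases hs with rfl | rfl <;> split_ifs at h1 <;> simpa using h1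

/-- A vector in the kernel of the matrix of components would be orthogonal to the whole tangent
space. -/
lemma det_metricComp_ne_zero {e : OpenPartialHomeomorph V E4}
    (he : e ∈ IsManifold.maximalAtlas (𝓡 4) ∞ V) {y : E4} (hy : y ∈ e.target)
    (g : LorentzMetric V) : (Matrix.of fun i j ↦ metricComp g e i j y).det ≠ 0 := by
  intro h0
  obtain ⟨c, hc, hcM⟩ := Matrix.exists_vecMul_eq_zero_iff.mpr h0
  set D := mfderiv 𝓘(ℝ, E4) (𝓡 4) e.symm y with hD
  set D' := mfderiv (𝓡 4) 𝓘(ℝ, E4) e (e.symm y) with hD'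
  have key : D (∑ i, c i • EuclideanSpace.single i (1 : ℝ) : E4) = 0 := by
    refine g.nondegenerate _ _ fun w ↦ ?_
    have hw := mfderiv_symm_mfderiv he hy w
    rw [← hw]
    have h1 := eq_sum_single (D' w : E4)
    set x : E4 := D' w with hx
    conv_lhs => rw [h1]
    have e1 : D (∑ i, c i • EuclideanSpace.single i (1 : ℝ) : E4)
        = ∑ i, c i • coordVec e y i :=
      map_sum D _ _ |>.trans (Finset.sum_congr rfl fun i _ ↦ map_smul D _ _)
    have e2 : D (∑ i, x i • EuclideanSpace.single i (1 : ℝ) : E4)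
        = ∑ i, x i • coordVec e y i :=
      map_sum D _ _ |>.trans (Finset.sum_congr rfl fun i _ ↦ map_smul D _ _)
    rw [e1]
    refine (congrArg _ e2).trans ?_
    rw [map_sum]
    refine Finset.sum_eq_zero fun j _ ↦ ?_
    rw [map_smul, map_sum, sum_apply]
    have := congrFun hcM j
    simp only [Matrix.vecMul, dotProduct, Matrix.of_apply, Pi.zero_apply, metricComp] at this
    simp only [map_smul, smul_apply, smul_eq_mul, this, mul_zero]
  have h2 := mfderiv_mfderiv_symm he hy (∑ i, c i • EuclideanSpace.single i (1 : ℝ) : E4)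
  rw [← hD, key, map_zero] at h2
  refine hc (funext fun i ↦ ?_)
  have h3 := congrArg (fun x : E4 ↦ x i) h2
  simp [Finset.sum_apply, Pi.single_apply] at h3
  exact h3.symm

lemma contMDiffOn_coordVec {e : OpenPartialHomeomorph V E4}
    (he : e ∈ IsManifold.maximalAtlas (𝓡 4) ∞ V) (i : Idx) :
    ContMDiffOn 𝓘(ℝ, E4) (𝓡 4).tangent ∞
      (fun y ↦ (⟨e.symm y, coordVec e y i⟩ : TangentBundle (𝓡 4) V)) e.target := by
  have h1 := (contMDiffOn_symm_of_mem_maximalAtlas he).contMDiffOn_tangentMapWithin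
    (m := ∞) (by simp) e.open_target.uniqueMDiffOn
  have h2 : ContMDiff 𝓘(ℝ, E4) 𝓘(ℝ, E4).tangent ∞
      (fun y : E4 ↦ (⟨y, (EuclideanSpace.single i (1 : ℝ) : E4)⟩ : TangentBundle 𝓘(ℝ, E4) E4)) := by
    exact contMDiff_vectorSpace_iff_contDiff.2 contDiff_const
  have h3 := h1.comp h2.contMDiffOn (s := e.target) (fun y hy ↦ hy)
  refine h3.congr fun y hy ↦ ?_
  simp only [Function.comp, tangentMapWithin, coordVec]
  rw [mfderivWithin_of_isOpen e.open_target hy]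

lemma contDiffOn_metricComp {e : OpenPartialHomeomorph V E4}
    (he : e ∈ IsManifold.maximalAtlas (𝓡 4) ∞ V) (g : LorentzMetric V) (i j : Idx) :
    ContDiffOn ℝ ∞ (metricComp g e i j) e.target := by
  have h := ContMDiffOn.clm_bundle_apply₂ (F₁ := E4) (F₂ := E4) (F₃ := ℝ)
    (E₃ := fun _ ↦ ℝ)
    (g.contMDiff.comp_contMDiffOn (contMDiffOn_symm_of_mem_maximalAtlas he))
    (contMDiffOn_coordVec he i) (contMDiffOn_coordVec he j)
  have h2 : ContMDiffOn 𝓘(ℝ, E4) 𝓘(ℝ, ℝ) ∞ (metricComp g e i j) e.target := by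
    intro y hy
    have := h y hy
    simp only [Bundle.contMDiffWithinAt_totalSpace] at this
    exact this.2
  exact h2.contDiffOn

lemma contDiffOn_upperComp {e : OpenPartialHomeomorph V E4}
    (he : e ∈ IsManifold.maximalAtlas (𝓡 4) ∞ V) {v : VField V} (hv : IsSmooth v) (i : Idx) :
    ContDiffOn ℝ ∞ (upperComp v e i) e.target := by
  have h1 := (contMDiffOn_of_mem_maximalAtlas he).contMDiffOn_tangentMapWithin
    (m := ∞) (by simp) e.open_source.uniqueMDiffOn
  have h2 := h1.comp (hv.comp_contMDiffOn (contMDiffOn_symm_of_mem_maximalAtlas he))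
    (fun y hy ↦ e.map_target hy)
  have h3 : ContMDiffOn 𝓘(ℝ, E4) 𝓘(ℝ, E4) ∞
      (fun y ↦ (mfderiv (𝓡 4) 𝓘(ℝ, E4) e (e.symm y) (v (e.symm y)) : E4)) e.target := by
    intro y hy
    have := h2 y hy
    rw [Bundle.contMDiffWithinAt_totalSpace] at this
    refine this.2.congr_of_mem (fun z hz ↦ ?_) hy
    simp only [Function.comp, tangentMapWithin]
    rw [mfderivWithin_of_isOpen e.open_source (e.map_target hz)]
    simp
    rfl
  exact (EuclideanSpace.proj i : E4 →L[ℝ] ℝ).contDiff.comp_contDiffOn h3.contDiffOn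

/-- Commuting vector fields, in components. -/
lemma sum_bracket_eq_zero {e : OpenPartialHomeomorph V E4}
    (he : e ∈ IsManifold.maximalAtlas (𝓡 4) ∞ V) {v w : VField V} (hv : IsSmooth v)
    (hw : IsSmooth w) (hvw : ∀ p : V, VectorField.mlieBracket (𝓡 4) v w p = 0) {y : E4}
    (hy : y ∈ e.target) (i : Idx) :
    ∑ j, (upperComp v e j y * pd j (upperComp w e i) y
      - upperComp w e j y * pd j (upperComp v e i) y) = 0 := by
  have hs := contMDiffAt_symm_of_mem_maximalAtlas he hy
  have h2 : (2 : WithTop ℕ∞) ≤ ∞ := by norm_cast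
  have : IsManifold (𝓡 4) (minSmoothness ℝ 2) V := IsManifold.of_le (n := ∞) (by simpa using h2)
  have h := VectorField.mpullback_mlieBracket (I := 𝓘(ℝ, E4)) (I' := 𝓡 4) (f := e.symm) (x₀ := y)
    (V := v) (W := w) ((hv _).mdifferentiableAt (by simp)) ((hw _).mdifferentiableAt (by simp)) hs
    (by simpa using h2)
  -- The pullback of a vector field to the chart has the contravariant components as coordinates.
  have hp : ∀ u : VField V, ∀ z ∈ e.target, VectorField.mpullback 𝓘(ℝ, E4) (𝓡 4) e.symm u z
      = (WithLp.toLp 2 (fun i ↦ upperComp u e i z) : E4) := by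
    intro u z hz
    have hinv : (mfderiv 𝓘(ℝ, E4) (𝓡 4) e.symm z).inverse
        = mfderiv (𝓡 4) 𝓘(ℝ, E4) e (e.symm z) := by
      refine ContinuousLinearMap.inverse_eq ?_ ?_
      · ext x
        exact mfderiv_symm_mfderiv he hz x
      · refine ContinuousLinearMap.ext fun x ↦ ?_
        exact mfderiv_mfderiv_symm he hz x
    rw [VectorField.mpullback_apply, hinv]
    rfl
  have hev : ∀ u : VField V, VectorField.mpullback 𝓘(ℝ, E4) (𝓡 4) e.symm u
      =ᶠ[nhds y] fun z ↦ (WithLp.toLp 2 (fun i ↦ upperComp u e i z) : E4) := fun u ↦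
    Filter.eventually_of_mem (e.open_target.mem_nhds hy) (hp u)
  have hb : ∀ a b : (z : E4) → TangentSpace 𝓘(ℝ, E4) z, VectorField.mlieBracket 𝓘(ℝ, E4) a b y
      = VectorField.lieBracket (E := E4) ℝ a b y := by
    intro a b
    rw [← VectorField.mlieBracketWithin_univ]
    erw [← VectorField.lieBracketWithin_univ]
    exact congrFun VectorField.mlieBracketWithin_eq_lieBracketWithin y
  rw [VectorField.mpullback_apply, hvw, map_zero,
    (hev v).mlieBracket_vectorField_eq (hev w)] at h
  replace h := h.trans (hb _ _)
  rw [VectorField.lieBracket_eq] at h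
  have hd : ∀ u : VField V, IsSmooth u → ∀ x : E4,
      (fderiv ℝ (fun z ↦ (WithLp.toLp 2 (fun i ↦ upperComp u e i z) : E4)) y x) i
        = ∑ j, x j * pd j (upperComp u e i) y := by
    intro u hu x
    have hdi : ∀ i, DifferentiableAt ℝ (upperComp u e i) y := fun i ↦
      ((contDiffOn_upperComp he hu i).contDiffAt (e.open_target.mem_nhds hy)).differentiableAt
        (by simp)
    have h3 : HasFDerivAt (fun z ↦ (WithLp.toLp 2 (fun i ↦ upperComp u e i z) : E4))
        ((PiLp.continuousLinearEquiv 2 ℝ (fun _ : Idx ↦ ℝ)).symm.toContinuousLinearMap ∘L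
          ContinuousLinearMap.pi fun i ↦ fderiv ℝ (upperComp u e i) y) y :=
      (PiLp.continuousLinearEquiv 2 ℝ (fun _ : Idx ↦ ℝ)).symm.toContinuousLinearMap.hasFDerivAt.comp
        y (hasFDerivAt_pi.2 fun i ↦ (hdi i).hasFDerivAt)
    rw [h3.fderiv]
    change fderiv ℝ (upperComp u e i) y x = _
    conv_lhs => rw [eq_sum_single x, map_sum]
    simp [pd]
  have h4 := congrArg (fun x : E4 ↦ x i) h
  simp only [PiLp.sub_apply, hd v hv, hd w hw] at h4
  rw [Finset.sum_sub_distrib]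
  exact h4.symm

end ChartBridge

/-! ### The Levi-Civita connection and its curvature in coordinates -/

section CoordinateCalculus

/-- The components `G` of a smooth nondegenerate metric on an open subset `U` of `ℝ⁴`. -/
structure IsMetricOn (U : Set E4) (G : Idx → Idx → E4 → ℝ) : Prop where
  isOpen : IsOpen U
  smooth (i j : Idx) : ContDiffOn ℝ ∞ (G i j) U
  symm (i j : Idx) : G i j = G j i
  det_ne_zero (y : E4) (hy : y ∈ U) : (Matrix.of fun i j ↦ G i j y).det ≠ 0

variable {U : Set E4} {f f' : E4 → ℝ} {y : E4}

lemma contDiffOn_pd (hU : IsOpen U) (hf : ContDiffOn ℝ ∞ f U) (i : Idx) :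
    ContDiffOn ℝ ∞ (pd i f) U :=
  (hf.fderiv_of_isOpen hU (by simp)).clm_apply contDiffOn_const

lemma differentiableAt_of_contDiffOn (hU : IsOpen U) (hf : ContDiffOn ℝ ∞ f U) (hy : y ∈ U) :
    DifferentiableAt ℝ f y :=
  (hf.contDiffAt (hU.mem_nhds hy)).differentiableAt (by simp)

lemma pd_add (hf : DifferentiableAt ℝ f y) (hf' : DifferentiableAt ℝ f' y) (i : Idx) :
    pd i (fun z ↦ f z + f' z) y = pd i f y + pd i f' y := by
  simp only [pd]
  rw [fderiv_fun_add hf hf', add_apply]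

lemma pd_sub (hf : DifferentiableAt ℝ f y) (hf' : DifferentiableAt ℝ f' y) (i : Idx) :
    pd i (fun z ↦ f z - f' z) y = pd i f y - pd i f' y := by
  simp only [pd]
  rw [fderiv_fun_sub hf hf', sub_apply]

lemma pd_mul (hf : DifferentiableAt ℝ f y) (hf' : DifferentiableAt ℝ f' y) (i : Idx) :
    pd i (fun z ↦ f z * f' z) y = pd i f y * f' y + f y * pd i f' y := by
  simp only [pd]
  rw [fderiv_fun_mul hf hf']
  simp only [add_apply, smul_apply, smul_eq_mul]
  ring

lemma pd_sum {F : Idx → E4 → ℝ} (hF : ∀ m, DifferentiableAt ℝ (F m) y) (i : Idx) :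
    pd i (fun z ↦ ∑ m, F m z) y = ∑ m, pd i (F m) y := by
  simp only [pd]
  rw [fderiv_fun_sum fun m _ ↦ hF m, sum_apply]

lemma pd_congr (h : f =ᶠ[nhds y] f') (i : Idx) : pd i f y = pd i f' y := by
  simp only [pd, h.fderiv_eq]

lemma pd_congr_on (hU : IsOpen U) (hy : y ∈ U) (h : ∀ z ∈ U, f z = f' z) (i : Idx) :
    pd i f y = pd i f' y :=
  pd_congr (Filter.eventually_of_mem (hU.mem_nhds hy) h) i

lemma pd_comm (hU : IsOpen U) (hf : ContDiffOn ℝ ∞ f U) (hy : y ∈ U) (i j : Idx) :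
    pd i (pd j f) y = pd j (pd i f) y := by
  have hc : ContDiffAt ℝ 2 f y := (hf.contDiffAt (hU.mem_nhds hy)).of_le (by norm_cast)
  have hs : IsSymmSndFDerivAt ℝ f y := hc.isSymmSndFDerivAt (by simp)
  have hd : DifferentiableAt ℝ (fderiv ℝ f) y :=
    (hc.fderiv_right (m := 1) (by norm_num)).differentiableAt (by simp)
  have h (i j : Idx) : pd i (pd j f) y
      = fderiv ℝ (fderiv ℝ f) y (EuclideanSpace.single i 1) (EuclideanSpace.single j 1) := by
    unfold pd
    rw [fderiv_clm_apply hd (by fun_prop)]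
    simp
  rw [h, h, hs]

/-- The covariant derivative `T_{ij;k}` of a tensor with two lower indices. For `T = covDeriv G w`
this is the second covariant derivative `w_{i;jk}`. -/
def covDerivTwo (G : Idx → Idx → E4 → ℝ) (T : Idx → Idx → E4 → ℝ) (i j k : Idx) (y : E4) : ℝ :=
  pd k (T i j) y - ∑ m, christoffel G m i k y * T m j y - ∑ m, christoffel G m j k y * T i m y

lemma riemann_swap_right (G : Idx → Idx → E4 → ℝ) (k l i j : Idx) (y : E4) :
    riemann G k l i j y = -riemann G k l j i y := by
  simp only [riemann, riemannUp, ← Finset.sum_neg_distrib]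
  refine Finset.sum_congr rfl fun m _ ↦ ?_
  simp only [Finset.sum_sub_distrib]
  ring

namespace IsMetricOn

variable {G : Idx → Idx → E4 → ℝ} (hG : IsMetricOn U G)
include hG

/-- By Cramer's rule, the inverse of a smooth nondegenerate metric is smooth. -/
lemma contDiffOn_metricInv (i j : Idx) : ContDiffOn ℝ ∞ (metricInv G i j) U := by
  have hdet : ∀ M : E4 → Matrix Idx Idx ℝ, (∀ i j, ContDiffOn ℝ ∞ (fun y ↦ M y i j) U) →
      ContDiffOn ℝ ∞ (fun y ↦ (M y).det) U := by
    intro M hM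
    simp only [Matrix.det_apply]
    refine ContDiffOn.sum fun s _ ↦ ContDiffOn.const_smul _ ?_
    exact contDiffOn_prod fun k _ ↦ hM _ _
  have h1 : metricInv G i j = fun y ↦ (Matrix.of fun a b ↦ G a b y).det⁻¹ *
      ((Matrix.of fun a b ↦ G a b y).updateRow j (Pi.single i 1)).det := by
    funext y
    simp [metricInv, Matrix.inv_def, Matrix.adjugate_apply]
  rw [h1]
  refine (ContDiffOn.inv (hdet _ fun i j ↦ hG.smooth i j) hG.det_ne_zero).mul (hdet _ fun a b ↦ ?_)
  by_cases h : a = j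
  · subst h
    simpa using contDiffOn_const
  · simpa [Matrix.updateRow_ne h] using hG.smooth a b

lemma metricInv_symm (i j : Idx) (y : E4) : metricInv G i j y = metricInv G j i y := by
  have h : (Matrix.of fun a b ↦ G a b y).transpose = Matrix.of fun a b ↦ G a b y := by
    ext a b
    exact congrFun (hG.symm b a) y
  simp only [metricInv]
  conv_lhs => rw [← h, ← Matrix.transpose_nonsing_inv, Matrix.transpose_apply]

lemma sum_mul_metricInv (hy : y ∈ U) (i k : Idx) :
    ∑ j, G i j y * metricInv G j k y = if i = k then 1 else 0 := by
  have h := Matrix.mul_nonsing_inv _ (hG.det_ne_zero y hy).isUnit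
  have := congrFun (congrFun h i) k
  rw [Matrix.mul_apply, Matrix.one_apply] at this
  exact this

lemma sum_mul_sum_metricInv (hy : y ∈ U) (i : Idx) (w : Idx → ℝ) :
    ∑ j, G i j y * ∑ k, metricInv G j k y * w k = w i := by
  simp only [Finset.mul_sum, ← mul_assoc]
  rw [Finset.sum_comm]
  simp [← Finset.sum_mul, hG.sum_mul_metricInv hy]

lemma christoffel_symm (k i j : Idx) : christoffel G k i j = christoffel G k j i := by
  funext y
  simp only [christoffel, hG.symm i j]
  congr 1
  exact Finset.sum_congr rfl fun l _ ↦ by ring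

lemma contDiffOn_christoffel (k i j : Idx) : ContDiffOn ℝ ∞ (christoffel G k i j) U :=
  contDiffOn_const.mul <| ContDiffOn.sum fun l _ ↦ (hG.contDiffOn_metricInv k l).mul <|
    ((contDiffOn_pd hG.isOpen (hG.smooth _ _) _).add
      (contDiffOn_pd hG.isOpen (hG.smooth _ _) _)).sub
      (contDiffOn_pd hG.isOpen (hG.smooth _ _) _)

lemma contDiffOn_covDeriv {w : Idx → E4 → ℝ} (hw : ∀ i, ContDiffOn ℝ ∞ (w i) U) (i j : Idx) :
    ContDiffOn ℝ ∞ (covDeriv G w i j) U :=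
  (contDiffOn_pd hG.isOpen (hw i) j).sub <| ContDiffOn.sum fun k _ ↦
    (hG.contDiffOn_christoffel k i j).mul (hw k)

/-- The Christoffel symbols of the first kind. -/
lemma sum_mul_christoffel (hy : y ∈ U) (k i j : Idx) :
    ∑ m, G k m y * christoffel G m i j y
      = (1 / 2) * (pd i (G j k) y + pd j (G i k) y - pd k (G i j) y) := by
  rw [← hG.sum_mul_sum_metricInv hy k fun l ↦
    (1 / 2) * (pd i (G j l) y + pd j (G i l) y - pd l (G i j) y)]
  refine Finset.sum_congr rfl fun m _ ↦ ?_
  simp only [christoffel, Finset.mul_sum]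
  exact Finset.sum_congr rfl fun l _ ↦ by ring

/-- The Levi-Civita connection is metric. -/
lemma pd_metric (hy : y ∈ U) (j k l : Idx) :
    pd j (G k l) y = ∑ m, G k m y * christoffel G m j l y
      + ∑ m, G l m y * christoffel G m j k y := by
  rw [hG.sum_mul_christoffel hy, hG.sum_mul_christoffel hy, hG.symm l k, hG.symm j k, hG.symm j l]
  ring

lemma riemann_cyclic (k l i j : Idx) (y : E4) :
    riemann G k l i j y + riemann G k i j l y + riemann G k j l i y = 0 := by
  simp only [riemann, ← Finset.sum_add_distrib]
  refine Finset.sum_eq_zero fun m _ ↦ ?_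
  simp only [riemannUp, Finset.sum_sub_distrib, hG.christoffel_symm _ j l,
    hG.christoffel_symm _ l i, hG.christoffel_symm _ j i]
  ring

/-- The antisymmetry of the Riemann tensor in its first two indices expresses that the second
partial derivatives of the metric, computed with `pd_metric`, commute. -/
lemma riemann_swap_left (hy : y ∈ U) (k l i j : Idx) :
    riemann G k l i j y = -riemann G l k i j y := by
  have hdG (a b : Idx) := differentiableAt_of_contDiffOn hG.isOpen (hG.smooth a b) hy
  have hdΓ (a b c : Idx) :=
    differentiableAt_of_contDiffOn hG.isOpen (hG.contDiffOn_christoffel a b c) hy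
  have key (i j : Idx) : pd i (pd j (G k l)) y
      = ∑ m, G k m y * pd i (christoffel G m j l) y + ∑ m, G l m y * pd i (christoffel G m j k) y
      + ∑ m, (∑ n, G k n y * christoffel G n i m y) * christoffel G m j l y
      + ∑ m, (∑ n, G l n y * christoffel G n i m y) * christoffel G m j k y
      + ∑ m, (∑ n, G m n y * christoffel G n i k y) * christoffel G m j l y
      + ∑ m, (∑ n, G m n y * christoffel G n i l y) * christoffel G m j k y := by
    rw [pd_congr_on hG.isOpen hy (fun z hz ↦ hG.pd_metric hz j k l),
      pd_add (.fun_sum fun m _ ↦ (hdG _ _).fun_mul (hdΓ _ _ _))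
        (.fun_sum fun m _ ↦ (hdG _ _).fun_mul (hdΓ _ _ _)),
      pd_sum fun m ↦ (hdG _ _).fun_mul (hdΓ _ _ _), pd_sum fun m ↦ (hdG _ _).fun_mul (hdΓ _ _ _)]
    simp only [pd_mul (hdG _ _) (hdΓ _ _ _), hG.pd_metric hy, add_mul, Finset.sum_add_distrib]
    ring
  have hquad (a b : Idx → ℝ) :
      ∑ m, (∑ n, G m n y * a n) * b m = ∑ m, (∑ n, G m n y * b n) * a m := by
    simp only [Finset.sum_mul]
    rw [Finset.sum_comm]
    exact Finset.sum_congr rfl fun m _ ↦ Finset.sum_congr rfl fun n _ ↦ by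
      rw [hG.symm n m]; ring
  have hexp (k l : Idx) : riemann G k l i j y
      = ∑ m, G k m y * pd i (christoffel G m j l) y - ∑ m, G k m y * pd j (christoffel G m i l) y
        + ∑ m, (∑ n, G k n y * christoffel G n i m y) * christoffel G m j l y
        - ∑ m, (∑ n, G k n y * christoffel G n j m y) * christoffel G m i l y := by
    have hs (i j : Idx) :
        ∑ m, G k m y * ∑ n, christoffel G m i n y * christoffel G n j l y
          = ∑ n, (∑ m, G k m y * christoffel G m i n y) * christoffel G n j l y := by
      simp only [Finset.mul_sum, Finset.sum_mul]
      rw [Finset.sum_comm]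
      simp only [mul_assoc]
    simp only [riemann, riemannUp, mul_add, mul_sub, Finset.sum_add_distrib,
      Finset.sum_sub_distrib, hs]
    ring
  have h := pd_comm hG.isOpen (hG.smooth k l) hy i j
  rw [key, key] at h
  have q1 := hquad (fun n ↦ christoffel G n i k y) (fun n ↦ christoffel G n j l y)
  have q2 := hquad (fun n ↦ christoffel G n i l y) (fun n ↦ christoffel G n j k y)
  rw [hexp, hexp]
  linarith

/-- The Ricci identity `w_{i;jk} - w_{i;kj} = R^m_{ijk} w_m`. -/
lemma ricci_identity {w : Idx → E4 → ℝ} (hw : ∀ i, ContDiffOn ℝ ∞ (w i) U) (hy : y ∈ U)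
    (i j k : Idx) :
    covDerivTwo G (covDeriv G w) i j k y - covDerivTwo G (covDeriv G w) i k j y
      = ∑ m, riemannUp G m i j k y * w m y := by
  have hdw (a : Idx) := differentiableAt_of_contDiffOn hG.isOpen (hw a) hy
  have hdp (a b : Idx) :=
    differentiableAt_of_contDiffOn hG.isOpen (contDiffOn_pd hG.isOpen (hw a) b) hy
  have hdΓ (a b c : Idx) :=
    differentiableAt_of_contDiffOn hG.isOpen (hG.contDiffOn_christoffel a b c) hy
  have key (j k : Idx) : pd k (covDeriv G w i j) y = pd k (pd j (w i)) y
      - ∑ m, pd k (christoffel G m i j) y * w m y - ∑ m, christoffel G m i j y * pd k (w m) y := by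
    have : covDeriv G w i j = fun y ↦ pd j (w i) y - ∑ k, christoffel G k i j y * w k y := rfl
    rw [this, pd_sub (hdp _ _) (.fun_sum fun m _ ↦ (hdΓ _ _ _).fun_mul (hdw _)),
      pd_sum fun m ↦ (hdΓ _ _ _).fun_mul (hdw _)]
    simp only [pd_mul (hdΓ _ _ _) (hdw _), Finset.sum_add_distrib]
    ring
  have hs (a : Idx → ℝ) (b : Idx → Idx → ℝ) :
      ∑ m, a m * ∑ n, b n m * w n y = ∑ n, (∑ m, b n m * a m) * w n y := by
    simp only [Finset.mul_sum, Finset.sum_mul]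
    rw [Finset.sum_comm]
    exact Finset.sum_congr rfl fun m _ ↦ Finset.sum_congr rfl fun n _ ↦ by ring
  have hexp (j k : Idx) : covDerivTwo G (covDeriv G w) i j k y = pd k (pd j (w i)) y
      - ∑ m, pd k (christoffel G m j i) y * w m y - ∑ m, christoffel G m j i y * pd k (w m) y
      - ∑ m, christoffel G m k i y * pd j (w m) y
      + ∑ n, (∑ m, christoffel G n j m y * christoffel G m k i y) * w n y
      - ∑ m, christoffel G m j k y * covDeriv G w i m y := by
    have hsym (n m : Idx) := hG.christoffel_symm n m j
    rw [covDerivTwo, key, ← hs]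
    have e1 : ∑ m, christoffel G m i k y * covDeriv G w m j y
        = ∑ m, christoffel G m k i y * pd j (w m) y
          - ∑ m, christoffel G m k i y * ∑ n, christoffel G n j m y * w n y := by
      rw [← Finset.sum_sub_distrib]
      refine Finset.sum_congr rfl fun m _ ↦ ?_
      rw [covDeriv, hG.christoffel_symm m i k]
      simp only [hsym, mul_sub]
    rw [e1]
    simp only [hG.christoffel_symm _ i j]
    ring
  rw [hexp, hexp, pd_comm hG.isOpen (hw i) hy]
  simp only [riemannUp, add_mul, sub_mul, Finset.sum_add_distrib, Finset.sum_sub_distrib,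
    hG.christoffel_symm _ j k]
  ring

end IsMetricOn

end CoordinateCalculus

/-! ### Multilinear forms at a point -/

section PointwiseForms

/-- Vectors at a point, given by their components. -/
abbrev Vec : Type := Idx → ℝ

/-- The linear form on `ℝ⁴` with components `w`. -/
def linForm (w : Idx → ℝ) : Vec →ₗ[ℝ] ℝ := ∑ i, w i • LinearMap.proj i

/-- The bilinear form on `ℝ⁴` with components `T`. -/
def bilForm (T : Idx → Idx → ℝ) : Vec →ₗ[ℝ] Vec →ₗ[ℝ] ℝ :=
  ∑ i, ∑ j, T i j • (LinearMap.proj i).smulRight (LinearMap.proj j)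

/-- The quadrilinear form on `ℝ⁴` with components `R`. -/
def quadForm (R : Idx → Idx → Idx → Idx → ℝ) :
    Vec →ₗ[ℝ] Vec →ₗ[ℝ] Vec →ₗ[ℝ] Vec →ₗ[ℝ] ℝ :=
  ∑ a, ∑ b, ∑ c, ∑ d, R a b c d • (LinearMap.proj a).smulRight
    ((LinearMap.proj b).smulRight ((LinearMap.proj c).smulRight (LinearMap.proj d)))

lemma linForm_apply (w v : Idx → ℝ) : linForm w v = ∑ i, w i * v i := by
  simp [linForm]

lemma bilForm_apply (T : Idx → Idx → ℝ) (v z : Idx → ℝ) :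
    bilForm T v z = ∑ i, ∑ j, T i j * (v i * z j) := by
  simp [bilForm]

lemma quadForm_apply (R : Idx → Idx → Idx → Idx → ℝ) (v z x w : Idx → ℝ) :
    quadForm R v z x w = ∑ a, ∑ b, ∑ c, ∑ d, R a b c d * (v a * (z b * (x c * w d))) := by
  simp [quadForm]

lemma linForm_single (w : Idx → ℝ) (i : Idx) : linForm w (Pi.single i 1) = w i := by
  simp [linForm_apply, Pi.single_apply]

lemma bilForm_single (T : Idx → Idx → ℝ) (i j : Idx) :
    bilForm T (Pi.single i 1) (Pi.single j 1) = T i j := by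
  simp [bilForm_apply, Pi.single_apply]

lemma quadForm_single (R : Idx → Idx → Idx → Idx → ℝ) (i j k l : Idx) :
    quadForm R (Pi.single i 1) (Pi.single j 1) (Pi.single k 1) (Pi.single l 1) = R i j k l := by
  simp [quadForm_apply, Pi.single_apply]

end PointwiseForms

/-! ### Covariant differentiation along a line -/

section CovariantDerivativeAlongLine

/-- The straight line in direction `W` through `y`. -/
def line (y : E4) (W : Idx → ℝ) (t : ℝ) : E4 := y + t • WithLp.toLp 2 W

lemma line_zero (y : E4) (W : Idx → ℝ) : line y W 0 = y := by simp [line]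

lemma continuous_line (y : E4) (W : Idx → ℝ) : Continuous (line y W) := by
  unfold line
  fun_prop

lemma hasDerivAt_comp_line {f : E4 → ℝ} {y : E4} (hf : DifferentiableAt ℝ f y) (W : Idx → ℝ) :
    HasDerivAt (fun t ↦ f (line y W t)) (∑ k, pd k f y * W k) 0 := by
  have h1 : HasDerivAt (line y W) (WithLp.toLp 2 W) 0 := by
    unfold line
    simpa using ((hasDerivAt_id (0 : ℝ)).smul_const (WithLp.toLp 2 W : E4)).const_add y
  have h2 : HasFDerivAt f (fderiv ℝ f y) (line y W 0) := by
    rw [line_zero]; exact hf.hasFDerivAt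
  have h3 := h2.comp_hasDerivAt 0 h1
  refine h3.congr_deriv ?_
  conv_lhs => rw [eq_sum_single (WithLp.toLp 2 W), map_sum]
  simp [pd, mul_comm]

/-- `V'` is the covariant derivative at `t = 0` of the vector field `V` along a line with velocity
`W`, with respect to the connection with coefficients `Γ` at that point. -/
def HasCovDerivAlong (Γ : Idx → Idx → Idx → ℝ) (W : Idx → ℝ) (V : ℝ → Idx → ℝ) (V' : Idx → ℝ) :
    Prop :=
  ∀ i, HasDerivAt (fun t ↦ V t i) (V' i - ∑ j, ∑ k, Γ i j k * (V 0 j * W k)) 0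

/-- A vector at a point extends along a line to a field that is parallel there to first order. -/
lemma exists_hasCovDerivAlong_zero (Γ : Idx → Idx → Idx → ℝ) (W v : Idx → ℝ) :
    ∃ V : ℝ → Idx → ℝ, V 0 = v ∧ HasCovDerivAlong Γ W V 0 := by
  refine ⟨fun t i ↦ v i + t * (- ∑ j, ∑ k, Γ i j k * (v j * W k)), by simp, fun i ↦ ?_⟩
  simpa using
    ((hasDerivAt_id (0 : ℝ)).mul_const (- ∑ j, ∑ k, Γ i j k * (v j * W k))).const_add (v i)

variable {G : Idx → Idx → E4 → ℝ} {y : E4} {W : Idx → ℝ} {V Z : ℝ → Idx → ℝ} {V' Z' : Idx → ℝ}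

/-- The product rule for `w(V)`. -/
lemma hasDerivAt_linForm {w : Idx → E4 → ℝ} (hw : ∀ i, DifferentiableAt ℝ (w i) y)
    (hV : HasCovDerivAlong (fun i j k ↦ christoffel G i j k y) W V V') :
    HasDerivAt (fun t ↦ linForm (fun i ↦ w i (line y W t)) (V t))
      (bilForm (fun i j ↦ covDeriv G w i j y) (V 0) W + linForm (fun i ↦ w i y) V') 0 := by
  simp only [linForm_apply]
  have h := HasDerivAt.fun_sum fun i (_ : i ∈ Finset.univ) ↦
    (hasDerivAt_comp_line (hw i) W).mul (hV i)
  refine h.congr_deriv ?_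
  simp only [line_zero, bilForm_apply, covDeriv, mul_sub, sub_mul, Finset.sum_add_distrib,
    Finset.sum_sub_distrib, Finset.sum_mul, Finset.mul_sum]
  have e : ∑ i, ∑ j, ∑ k, w i y * (christoffel G i j k y * (V 0 j * W k))
      = ∑ i, ∑ j, ∑ m, christoffel G m i j y * w m y * (V 0 i * W j) := by
    rw [Finset.sum_comm]
    refine Finset.sum_congr rfl fun j _ ↦ ?_
    rw [Finset.sum_comm]
    refine Finset.sum_congr rfl fun k _ ↦ Finset.sum_congr rfl fun m _ ↦ by ring
  rw [e]
  have e2 : ∑ i, ∑ j, pd j (w i) y * W j * V 0 i = ∑ i, ∑ j, pd j (w i) y * (V 0 i * W j) :=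
    Finset.sum_congr rfl fun k _ ↦ Finset.sum_congr rfl fun m _ ↦ by ring
  rw [e2]
  ring

/-- The product rule for `T(V, Z)`. -/
lemma hasDerivAt_bilForm {T : Idx → Idx → E4 → ℝ} (hT : ∀ i j, DifferentiableAt ℝ (T i j) y)
    (hV : HasCovDerivAlong (fun i j k ↦ christoffel G i j k y) W V V')
    (hZ : HasCovDerivAlong (fun i j k ↦ christoffel G i j k y) W Z Z') :
    HasDerivAt (fun t ↦ bilForm (fun i j ↦ T i j (line y W t)) (V t) (Z t))
      ((∑ i, ∑ j, ∑ k, covDerivTwo G T i j k y * (V 0 i * (Z 0 j * W k)))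
        + bilForm (fun i j ↦ T i j y) V' (Z 0) + bilForm (fun i j ↦ T i j y) (V 0) Z') 0 := by
  simp only [bilForm_apply]
  have h := HasDerivAt.fun_sum fun i (_ : i ∈ Finset.univ) ↦
    HasDerivAt.fun_sum fun j (_ : j ∈ Finset.univ) ↦
      (hasDerivAt_comp_line (hT i j) W).mul ((hV i).mul (hZ j))
  refine h.congr_deriv ?_
  have e1 : ∑ i, ∑ j, T i j y * ((∑ a, ∑ b, christoffel G i a b y * (V 0 a * W b)) * Z 0 j)
      = ∑ i, ∑ j, ∑ k, (∑ m, christoffel G m i k y * T m j y) * (V 0 i * (Z 0 j * W k)) := by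
    simp only [Finset.sum_mul, Finset.mul_sum]
    calc _ = ∑ i, ∑ a, ∑ j, ∑ b, T i j y * (christoffel G i a b y * (V 0 a * W b) * Z 0 j) :=
          Finset.sum_congr rfl fun i _ ↦ Finset.sum_comm
      _ = ∑ a, ∑ i, ∑ j, ∑ b, T i j y * (christoffel G i a b y * (V 0 a * W b) * Z 0 j) :=
          Finset.sum_comm
      _ = ∑ a, ∑ j, ∑ i, ∑ b, T i j y * (christoffel G i a b y * (V 0 a * W b) * Z 0 j) :=
          Finset.sum_congr rfl fun i _ ↦ Finset.sum_comm
      _ = ∑ a, ∑ j, ∑ b, ∑ i, T i j y * (christoffel G i a b y * (V 0 a * W b) * Z 0 j) :=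
          Finset.sum_congr rfl fun i _ ↦ Finset.sum_congr rfl fun i _ ↦ Finset.sum_comm
      _ = _ := by
          refine Finset.sum_congr rfl fun i _ ↦ Finset.sum_congr rfl fun j _ ↦
            Finset.sum_congr rfl fun k _ ↦ Finset.sum_congr rfl fun m _ ↦ by ring
  have e2 : ∑ i, ∑ j, T i j y * (V 0 i * (∑ a, ∑ b, christoffel G j a b y * (Z 0 a * W b)))
      = ∑ i, ∑ j, ∑ k, (∑ m, christoffel G m j k y * T i m y) * (V 0 i * (Z 0 j * W k)) := by
    simp only [Finset.sum_mul, Finset.mul_sum]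
    refine Finset.sum_congr rfl fun i _ ↦ ?_
    calc _ = ∑ a, ∑ j, ∑ b, T i j y * (V 0 i * (christoffel G j a b y * (Z 0 a * W b))) :=
          Finset.sum_comm
      _ = ∑ a, ∑ b, ∑ j, T i j y * (V 0 i * (christoffel G j a b y * (Z 0 a * W b))) :=
          Finset.sum_congr rfl fun i _ ↦ Finset.sum_comm
      _ = _ := by
          refine Finset.sum_congr rfl fun j _ ↦
            Finset.sum_congr rfl fun k _ ↦ Finset.sum_congr rfl fun m _ ↦ by ring
  have e3 : ∑ i, ∑ j, (∑ k, pd k (T i j) y * W k) * (V 0 i * Z 0 j)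
      = ∑ i, ∑ j, ∑ k, pd k (T i j) y * (V 0 i * (Z 0 j * W k)) := by
    simp only [Finset.sum_mul]
    refine Finset.sum_congr rfl fun j _ ↦
            Finset.sum_congr rfl fun k _ ↦ Finset.sum_congr rfl fun m _ ↦ by ring
  simp only [Pi.mul_apply, line_zero, covDerivTwo, sub_mul, mul_sub, mul_add,
    Finset.sum_add_distrib, Finset.sum_sub_distrib, e1, e2, e3]
  ring

end CovariantDerivativeAlongLine

/-! ### The second derivative of a Killing field -/

section KillingOneForm

variable {U : Set E4} {y : E4} {G : Idx → Idx → E4 → ℝ} {w u : Idx → E4 → ℝ}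

/-- The Killing equation differentiated: `ξ_{i;jk} = -R_{akij} ξ^a`. -/
lemma IsMetricOn.covDerivTwo_of_killing (hG : IsMetricOn U G) (hw : ∀ i, ContDiffOn ℝ ∞ (w i) U)
    (hk : ∀ z ∈ U, ∀ i j, covDeriv G w i j z = -covDeriv G w j i z) (hy : y ∈ U)
    (hu : ∀ i, w i y = ∑ j, G i j y * u j y) (i j k : Idx) :
    covDerivTwo G (covDeriv G w) i j k y = -∑ a, u a y * riemann G a k i j y := by
  have hric (i j k : Idx) : covDerivTwo G (covDeriv G w) i j k y
      = covDerivTwo G (covDeriv G w) i k j y + ∑ a, u a y * riemann G a i j k y := by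
    have h := hG.ricci_identity hw hy i j k
    have e : ∑ m, riemannUp G m i j k y * w m y = ∑ a, u a y * riemann G a i j k y := by
      simp only [hu, riemann, Finset.mul_sum]
      rw [Finset.sum_comm]
      refine Finset.sum_congr rfl fun a _ ↦ Finset.sum_congr rfl fun m _ ↦ ?_
      rw [hG.symm m a]
      ring
    linarith
  have hanti (i j k : Idx) : covDerivTwo G (covDeriv G w) i j k y
      = -covDerivTwo G (covDeriv G w) j i k y := by
    have h1 : pd k (covDeriv G w i j) y = -pd k (covDeriv G w j i) y := by
      rw [pd_congr_on hG.isOpen hy fun z hz ↦ hk z hz i j]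
      simp [pd]
    simp only [covDerivTwo, h1]
    have h2 : ∑ m, christoffel G m i k y * covDeriv G w m j y
        = -∑ m, christoffel G m i k y * covDeriv G w j m y := by
      rw [← Finset.sum_neg_distrib]
      exact Finset.sum_congr rfl fun m _ ↦ by rw [hk y hy m j]; ring
    have h3 : ∑ m, christoffel G m j k y * covDeriv G w i m y
        = -∑ m, christoffel G m j k y * covDeriv G w m i y := by
      rw [← Finset.sum_neg_distrib]
      exact Finset.sum_congr rfl fun m _ ↦ by rw [hk y hy i m]; ring
    rw [h2, h3]
    ring
  have hcyc : ∑ a, u a y * riemann G a i j k y + ∑ a, u a y * riemann G a j k i y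
      + ∑ a, u a y * riemann G a k i j y = 0 := by
    simp only [← Finset.sum_add_distrib, ← mul_add]
    exact Finset.sum_eq_zero fun a _ ↦ by
      linear_combination u a y * hG.riemann_cyclic a i j k y
  linarith [hric i j k, hric j k i, hric k i j, hanti i j k, hanti j k i, hanti k i j,
    hanti i k j, hanti j i k, hanti k j i]

/-- `ξ_{i;j} = g_{ik} (∂ⱼ ξ^k + Γ^k_{lj} ξ^l)`. -/
lemma IsMetricOn.covDeriv_eq_sum (hG : IsMetricOn U G) (hd : ∀ i, DifferentiableAt ℝ (u i) y)
    (hy : y ∈ U) (hu : ∀ z ∈ U, ∀ i, w i z = ∑ j, G i j z * u j z) (i j : Idx) :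
    covDeriv G w i j y
      = ∑ k, G i k y * (pd j (u k) y + ∑ l, christoffel G k l j y * u l y) := by
  have hdG (a b : Idx) := differentiableAt_of_contDiffOn hG.isOpen (hG.smooth a b) hy
  rw [covDeriv, pd_congr_on hG.isOpen hy fun z hz ↦ hu z hz i,
    pd_sum fun m ↦ (hdG _ _).fun_mul (hd _)]
  simp only [pd_mul (hdG _ _) (hd _), hG.pd_metric hy, Finset.sum_add_distrib, mul_add, hu y hy,
    add_mul]
  have e1 : ∑ k, christoffel G k i j y * ∑ l, G k l y * u l y
      = ∑ l, (∑ m, G l m y * christoffel G m j i y) * u l y := by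
    simp only [Finset.mul_sum, Finset.sum_mul]
    rw [Finset.sum_comm]
    refine Finset.sum_congr rfl fun l _ ↦ Finset.sum_congr rfl fun m _ ↦ ?_
    rw [hG.symm m l, hG.christoffel_symm m i j]
    ring
  have e2 : ∑ k, G i k y * ∑ l, christoffel G k l j y * u l y
      = ∑ l, (∑ m, G i m y * christoffel G m j l y) * u l y := by
    simp only [Finset.mul_sum, Finset.sum_mul]
    rw [Finset.sum_comm]
    refine Finset.sum_congr rfl fun l _ ↦ Finset.sum_congr rfl fun m _ ↦ ?_
    rw [hG.christoffel_symm m l j]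
    ring
  rw [e1, e2]
  ring

end KillingOneForm

/-! ### Antisymmetrized conditions -/

section Antisymmetrization

lemma sum_perm_two (φ : Fin 2 → Fin 2 → ℝ) :
    ∑ s : Equiv.Perm (Fin 2), ((Equiv.Perm.sign s : ℤ) : ℝ) * φ (s 0) (s 1)
      = φ 0 1 - φ 1 0 := by
  have h : (Finset.univ : Finset (Equiv.Perm (Fin 2))) = {1, Equiv.swap 0 1} := by decide
  rw [h, Finset.sum_insert (by decide), Finset.sum_singleton]
  simp
  ring

lemma sum_perm_three (φ : Fin 3 → Fin 3 → Fin 3 → ℝ) :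
    ∑ s : Equiv.Perm (Fin 3), ((Equiv.Perm.sign s : ℤ) : ℝ) * φ (s 0) (s 1) (s 2)
      = φ 0 1 2 - φ 0 2 1 - φ 1 0 2 + φ 1 2 0 + φ 2 0 1 - φ 2 1 0 := by
  have h : (Finset.univ : Finset (Equiv.Perm (Fin 3))) = {1, Equiv.swap 0 1, Equiv.swap 0 2,
      Equiv.swap 1 2, Equiv.swap 0 1 * Equiv.swap 1 2, Equiv.swap 1 2 * Equiv.swap 0 1} := by
    decide
  rw [h, Finset.sum_insert (by decide), Finset.sum_insert (by decide),
    Finset.sum_insert (by decide), Finset.sum_insert (by decide), Finset.sum_insert (by decide),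
    Finset.sum_singleton]
  simp [Equiv.swap_apply_def]
  ring

/-- A sum over `S₄` is split by the image of `0` into four sums over `S₃`. -/
lemma sum_perm_four (φ : Fin 4 → Fin 4 → Fin 4 → Fin 4 → ℝ) :
    ∑ s : Equiv.Perm (Fin 4), ((Equiv.Perm.sign s : ℤ) : ℝ) * φ (s 0) (s 1) (s 2) (s 3)
      = (φ 0 1 2 3 - φ 0 1 3 2) - (φ 0 2 1 3 - φ 0 2 3 1) + (φ 0 3 1 2 - φ 0 3 2 1)
        - (φ 1 0 2 3 - φ 1 0 3 2) + (φ 2 0 1 3 - φ 2 0 3 1) - (φ 3 0 1 2 - φ 3 0 2 1)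
        + (φ 1 2 0 3 - φ 1 2 3 0) - (φ 1 3 0 2 - φ 1 3 2 0) - (φ 2 1 0 3 - φ 2 1 3 0)
        + (φ 3 1 0 2 - φ 3 1 2 0) + (φ 2 3 0 1 - φ 2 3 1 0) - (φ 3 2 0 1 - φ 3 2 1 0) := by
  have h : ∀ p : Fin 4, ∑ e : Equiv.Perm (Fin 3),
      ((Equiv.Perm.sign (Equiv.Perm.decomposeFin.symm (p, e)) : ℤ) : ℝ)
        * φ (Equiv.Perm.decomposeFin.symm (p, e) 0) (Equiv.Perm.decomposeFin.symm (p, e) 1)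
          (Equiv.Perm.decomposeFin.symm (p, e) 2) (Equiv.Perm.decomposeFin.symm (p, e) 3)
      = (if p = 0 then 1 else -1) * ∑ e : Equiv.Perm (Fin 3), ((Equiv.Perm.sign e : ℤ) : ℝ)
        * φ p (Equiv.swap 0 p (e 0).succ) (Equiv.swap 0 p (e 1).succ)
          (Equiv.swap 0 p (e 2).succ) := by
    intro p
    rw [Finset.mul_sum]
    refine Finset.sum_congr rfl fun e _ ↦ ?_
    have h1 := Equiv.Perm.decomposeFin_symm_apply_succ e p 0
    have h2 := Equiv.Perm.decomposeFin_symm_apply_succ e p 1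
    have h3 := Equiv.Perm.decomposeFin_symm_apply_succ e p 2
    simp only [Fin.succ_zero_eq_one, Fin.succ_one_eq_two, show (2 : Fin 3).succ = 3 from rfl]
      at h1 h2 h3
    rw [Equiv.Perm.decomposeFin_symm_apply_zero, h1, h2, h3, Equiv.Perm.decomposeFin.symm_sign]
    split_ifs <;> simp
  rw [← Equiv.sum_comp Equiv.Perm.decomposeFin.symm, Fintype.sum_prod_type]
  have h' (p : Fin 4) := sum_perm_three fun i j k ↦ φ p (Equiv.swap 0 p i.succ)
    (Equiv.swap 0 p j.succ) (Equiv.swap 0 p k.succ)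
  simp only [h, h', Fin.sum_univ_four]
  simp [Equiv.swap_apply_def]
  ring

lemma antisymz_two_eq (T : (Fin 2 → Idx) → ℝ) (a : Fin 2 → Idx) :
    antisymz T a = (1 / 2) * (T ![a 0, a 1] - T ![a 1, a 0]) := by
  have h := sum_perm_two fun i j ↦ T ![a i, a j]
  have e (s : Equiv.Perm (Fin 2)) : a ∘ s = ![a (s 0), a (s 1)] := by
    ext i; fin_cases i <;> rfl
  simp only [antisymz, e, h]
  norm_num

lemma antisymz_three_eq (T : (Fin 3 → Idx) → ℝ) (a : Fin 3 → Idx) :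
    antisymz T a = (1 / 6) * (T ![a 0, a 1, a 2] - T ![a 0, a 2, a 1] - T ![a 1, a 0, a 2]
      + T ![a 1, a 2, a 0] + T ![a 2, a 0, a 1] - T ![a 2, a 1, a 0]) := by
  have h := sum_perm_three fun i j k ↦ T ![a i, a j, a k]
  have e (s : Equiv.Perm (Fin 3)) : a ∘ s = ![a (s 0), a (s 1), a (s 2)] := by
    ext i; fin_cases i <;> rfl
  simp only [antisymz, e, h]
  norm_num [Nat.factorial]

/-- `v_{[i} w_j F_{kl]} = 0` for an antisymmetric `F`, written out. -/
lemma sum_eq_zero_of_antisymz_four {v w : Idx → ℝ} {F : Idx → Idx → ℝ}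
    (hF : ∀ i j, F i j = -F j i)
    (h : ∀ a : Fin 4 → Idx,
      antisymz (fun b : Fin 4 → Idx ↦ v (b 0) * w (b 1) * F (b 2) (b 3)) a = 0) (i j k l : Idx) :
    (v i * w j - v j * w i) * F k l - (v i * w k - v k * w i) * F j l
      + (v i * w l - v l * w i) * F j k + (v j * w k - v k * w j) * F i l
      - (v j * w l - v l * w j) * F i k + (v k * w l - v l * w k) * F i j = 0 := by
  have h1 := h ![i, j, k, l]
  simp only [antisymz, Function.comp] at h1
  rw [sum_perm_four fun p q r s ↦ v (![i, j, k, l] p) * w (![i, j, k, l] q)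
    * F (![i, j, k, l] r) (![i, j, k, l] s)] at h1
  have h2 := (mul_eq_zero.mp h1).resolve_left (by positivity)
  simp only [Matrix.cons_val] at h2
  rw [hF l k, hF l j, hF k j, hF l i, hF k i, hF j i] at h2
  linarith

lemma sum_eq_zero_of_antisymz_three {v : Idx → ℝ} {F : Idx → Idx → ℝ}
    (hF : ∀ i j, F i j = -F j i)
    (h : ∀ a : Fin 3 → Idx,
      antisymz (fun b : Fin 3 → Idx ↦ v (b 0) * F (b 1) (b 2)) a = 0) (i j k : Idx) :
    v i * F j k - v j * F i k + v k * F i j = 0 := by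
  have h1 := h ![i, j, k]
  rw [antisymz_three_eq] at h1
  simp only [Matrix.cons_val] at h1
  rw [hF k j, hF k i, hF j i] at h1
  linarith

/-- A function that is linear and vanishes on the standard basis is zero. -/
lemma eq_zero_of_linear {φ : Vec → ℝ} (hadd : ∀ v z, φ (v + z) = φ v + φ z)
    (hsmul : ∀ (c : ℝ) v, φ (c • v) = c * φ v) (h : ∀ i, φ (Pi.single i 1) = 0)
    (v : Idx → ℝ) : φ v = 0 := by
  let L : Vec →ₗ[ℝ] ℝ := { toFun := φ, map_add' := hadd, map_smul' := by simpa using hsmul }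
  have : L = 0 := by
    refine (Pi.basisFun ℝ Idx).ext fun i ↦ ?_
    simpa [L] using h i
  exact congrArg (fun M ↦ M v) this

/-- The passage from `v_{[i} F_{jk]} = 0` in components to arbitrary vectors. -/
lemma linForm_bilForm_wedge {v : Idx → ℝ} {F : Idx → Idx → ℝ}
    (h : ∀ i j k, v i * F j k - v j * F i k + v k * F i j = 0) (A B C : Idx → ℝ) :
    linForm v A * bilForm F B C - linForm v B * bilForm F A C + linForm v C * bilForm F A B
      = 0 := by
  refine eq_zero_of_linear (φ := fun A ↦ linForm v A * bilForm F B C - linForm v B * bilForm F A C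
    + linForm v C * bilForm F A B) (fun _ _ ↦ by simp; ring) (fun _ _ ↦ by simp; ring) ?_ A
  intro i
  refine eq_zero_of_linear (φ := fun B ↦ linForm v (Pi.single i 1) * bilForm F B C
    - linForm v B * bilForm F (Pi.single i 1) C + linForm v C * bilForm F (Pi.single i 1) B)
    (fun _ _ ↦ by simp; ring) (fun _ _ ↦ by simp; ring) ?_ B
  intro j
  refine eq_zero_of_linear (φ := fun C ↦ linForm v (Pi.single i 1) * bilForm F (Pi.single j 1) C
    - linForm v (Pi.single j 1) * bilForm F (Pi.single i 1) C
    + linForm v C * bilForm F (Pi.single i 1) (Pi.single j 1))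
    (fun _ _ ↦ by simp; ring) (fun _ _ ↦ by simp; ring) ?_ C
  intro k
  simpa only [linForm_single, bilForm_single] using h i j k

/-- The value of the four-form `α ∧ β ∧ F` (up to a factor) on four vectors. -/
def wedgeForm {E : Type*} (α β : E → ℝ) (F : E → E → ℝ) (A B C D : E) : ℝ :=
  (α A * β B - α B * β A) * F C D - (α A * β C - α C * β A) * F B D
    + (α A * β D - α D * β A) * F B C + (α B * β C - α C * β B) * F A D
    - (α B * β D - α D * β B) * F A C + (α C * β D - α D * β C) * F A B

/-- The passage from `v_{[i} w_j F_{kl]} = 0` in components to arbitrary vectors. -/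
lemma wedgeForm_eq_zero {v w : Idx → ℝ} {F : Idx → Idx → ℝ}
    (h : ∀ i j k l, wedgeForm v w F i j k l = 0) (A B C D : Idx → ℝ) :
    wedgeForm (linForm v) (linForm w) (fun X Y ↦ bilForm F X Y) A B C D = 0 := by
  refine eq_zero_of_linear (φ := fun A ↦
    wedgeForm (linForm v) (linForm w) (fun X Y ↦ bilForm F X Y) A B C D)
    (fun _ _ ↦ by simp [wedgeForm]; ring) (fun _ _ ↦ by simp [wedgeForm]; ring) (fun i ↦ ?_) A
  refine eq_zero_of_linear (φ := fun B ↦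
    wedgeForm (linForm v) (linForm w) (fun X Y ↦ bilForm F X Y) (Pi.single i 1) B C D)
    (fun _ _ ↦ by simp [wedgeForm]; ring) (fun _ _ ↦ by simp [wedgeForm]; ring) (fun j ↦ ?_) B
  refine eq_zero_of_linear (φ := fun C ↦
    wedgeForm (linForm v) (linForm w) (fun X Y ↦ bilForm F X Y) (Pi.single i 1)
      (Pi.single j 1) C D)
    (fun _ _ ↦ by simp [wedgeForm]; ring) (fun _ _ ↦ by simp [wedgeForm]; ring) (fun k ↦ ?_) C
  refine eq_zero_of_linear (φ := fun D ↦
    wedgeForm (linForm v) (linForm w) (fun X Y ↦ bilForm F X Y) (Pi.single i 1)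
      (Pi.single j 1) (Pi.single k 1) D)
    (fun _ _ ↦ by simp [wedgeForm]; ring) (fun _ _ ↦ by simp [wedgeForm]; ring) (fun l ↦ ?_) D
  simpa only [wedgeForm, linForm_single, bilForm_single] using h i j k l

end Antisymmetrization

/-! ### Differentiated conditions on Killing fields -/

section KillingFields

/-- The metric at the point `y`, as a bilinear form. -/
abbrev metricForm (G : Idx → Idx → E4 → ℝ) (y : E4) := bilForm fun i j ↦ G i j y

/-- The covector field with components `w` at the point `y`, as a linear form. -/
abbrev lowerForm (w : Idx → E4 → ℝ) (y : E4) := linForm fun i ↦ w i y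

/-- The covariant derivative `w_{i;j}` at the point `y`, as a bilinear form. -/
abbrev covDerivForm (G : Idx → Idx → E4 → ℝ) (w : Idx → E4 → ℝ) (y : E4) :=
  bilForm fun i j ↦ covDeriv G w i j y

/-- The Riemann tensor at the point `y`, as a quadrilinear form. -/
abbrev riemannForm (G : Idx → Idx → E4 → ℝ) (y : E4) := quadForm fun a b c d ↦ riemann G a b c d y

/-- `u` are the contravariant and `w` the covariant components of a Killing vector field of the
metric `G` on `U`. -/
structure IsKillingOn (U : Set E4) (G : Idx → Idx → E4 → ℝ) (u w : Idx → E4 → ℝ) : Prop where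
  smooth_upper (i : Idx) : ContDiffOn ℝ ∞ (u i) U
  smooth_lower (i : Idx) : ContDiffOn ℝ ∞ (w i) U
  lower (z : E4) (hz : z ∈ U) (i : Idx) : w i z = ∑ j, G i j z * u j z
  killing (z : E4) (hz : z ∈ U) (i j : Idx) : covDeriv G w i j z = -covDeriv G w j i z

variable {U : Set E4} {y : E4} {G : Idx → Idx → E4 → ℝ} {u w u₁ w₁ u₂ w₂ : Idx → E4 → ℝ}

/-- The covariant components of `ξ` are those of the linear form `g(ξ, ·)`. -/
lemma linForm_eq_bilForm (hG : IsMetricOn U G) (hK : IsKillingOn U G u w) (hy : y ∈ U)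
    (v : Idx → ℝ) :
    lowerForm w y v = metricForm G y (fun i ↦ u i y) v := by
  simp only [linForm_apply, bilForm_apply, hK.lower y hy, Finset.sum_mul]
  rw [Finset.sum_comm]
  exact Finset.sum_congr rfl fun i _ ↦ Finset.sum_congr rfl fun j _ ↦ by
    rw [hG.symm j i]; ring

lemma bilForm_antisymm {F : Idx → Idx → ℝ} (hF : ∀ i j, F i j = -F j i) (v z : Idx → ℝ) :
    bilForm F v z = -bilForm F z v := by
  simp only [bilForm_apply, ← Finset.sum_neg_distrib]
  rw [Finset.sum_comm]
  exact Finset.sum_congr rfl fun i _ ↦ Finset.sum_congr rfl fun j _ ↦ by rw [hF j i]; ring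

/-- The derivative of `w_i V^i` for a parallel vector `V`. -/
lemma hasDerivAt_linForm_parallel (hG : IsMetricOn U G) (hK : IsKillingOn U G u w) (hy : y ∈ U)
    {W : Idx → ℝ} {V : ℝ → Idx → ℝ}
    (hV : HasCovDerivAlong (fun i j k ↦ christoffel G i j k y) W V 0) :
    HasDerivAt (fun t ↦ lowerForm w (line y W t) (V t))
      (covDerivForm G w y (V 0) W) 0 := by
  simpa using hasDerivAt_linForm
    (fun i ↦ differentiableAt_of_contDiffOn hG.isOpen (hK.smooth_lower i) hy) hV

/-- The derivative of `w_{i;j} V^i Z^j`, where the second derivative of the Killing field is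
expressed by the curvature. -/
lemma hasDerivAt_bilForm_covDeriv (hG : IsMetricOn U G) (hK : IsKillingOn U G u w) (hy : y ∈ U)
    {W : Idx → ℝ} {V Z : ℝ → Idx → ℝ} {V' Z' : Idx → ℝ}
    (hV : HasCovDerivAlong (fun i j k ↦ christoffel G i j k y) W V V')
    (hZ : HasCovDerivAlong (fun i j k ↦ christoffel G i j k y) W Z Z') :
    HasDerivAt (fun t ↦ covDerivForm G w (line y W t) (V t) (Z t))
      (-riemannForm G y (fun i ↦ u i y) W (V 0) (Z 0)
        + covDerivForm G w y V' (Z 0)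
        + covDerivForm G w y (V 0) Z') 0 := by
  have h := hasDerivAt_bilForm (fun i j ↦ differentiableAt_of_contDiffOn hG.isOpen
    (hG.contDiffOn_covDeriv hK.smooth_lower i j) hy) hV hZ
  refine h.congr_deriv ?_
  congr 2
  simp only [hG.covDerivTwo_of_killing hK.smooth_lower hK.killing hy (hK.lower y hy),
    quadForm_apply, neg_mul, Finset.sum_neg_distrib, Finset.sum_mul]
  congr 1
  calc _ = ∑ i, ∑ j, ∑ a, ∑ k, u a y * riemann G a k i j y * (V 0 i * (Z 0 j * W k)) :=
        Finset.sum_congr rfl fun i _ ↦ Finset.sum_congr rfl fun i _ ↦ Finset.sum_comm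
    _ = ∑ i, ∑ a, ∑ j, ∑ k, u a y * riemann G a k i j y * (V 0 i * (Z 0 j * W k)) :=
        Finset.sum_congr rfl fun i _ ↦ Finset.sum_comm
    _ = ∑ a, ∑ i, ∑ j, ∑ k, u a y * riemann G a k i j y * (V 0 i * (Z 0 j * W k)) :=
        Finset.sum_comm
    _ = ∑ a, ∑ i, ∑ k, ∑ j, u a y * riemann G a k i j y * (V 0 i * (Z 0 j * W k)) :=
        Finset.sum_congr rfl fun i _ ↦ Finset.sum_congr rfl fun i _ ↦ Finset.sum_comm
    _ = ∑ a, ∑ k, ∑ i, ∑ j, u a y * riemann G a k i j y * (V 0 i * (Z 0 j * W k)) :=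
        Finset.sum_congr rfl fun i _ ↦ Finset.sum_comm
    _ = _ := by
        refine Finset.sum_congr rfl fun i _ ↦ Finset.sum_congr rfl fun j _ ↦
          Finset.sum_congr rfl fun k _ ↦ Finset.sum_congr rfl fun m _ ↦ by ring

lemma hasDerivAt_bilForm_parallel (hG : IsMetricOn U G) (hK : IsKillingOn U G u w) (hy : y ∈ U)
    {W : Idx → ℝ} {V Z : ℝ → Idx → ℝ}
    (hV : HasCovDerivAlong (fun i j k ↦ christoffel G i j k y) W V 0)
    (hZ : HasCovDerivAlong (fun i j k ↦ christoffel G i j k y) W Z 0) :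
    HasDerivAt (fun t ↦ covDerivForm G w (line y W t) (V t) (Z t))
      (-riemannForm G y (fun i ↦ u i y) W (V 0) (Z 0)) 0 := by
  simpa using hasDerivAt_bilForm_covDeriv hG hK hy hV hZ

/-- A consequence `φ = 0` of a relation `f` that holds on an open set can be differentiated along
lines. -/
lemma eq_zero_of_hasDerivAt {f : E4 → Prop} (hU : IsOpen U) (hf : ∀ z ∈ U, f z) (hy : y ∈ U)
    {W : Idx → ℝ} {φ : ℝ → ℝ} {c : ℝ} (hφ : ∀ t, f (line y W t) → φ t = 0)
    (h : HasDerivAt φ c 0) : c = 0 := by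
  have hev : ∀ᶠ t in nhds (0 : ℝ), φ t = 0 := by
    have := (continuous_line y W).continuousAt.preimage_mem_nhds (x := 0)
      (t := U) (by rw [line_zero]; exact hU.mem_nhds hy)
    filter_upwards [this] with t ht using hφ t (hf _ ht)
  have h0 : HasDerivAt φ 0 0 := (hasDerivAt_const (0 : ℝ) (0 : ℝ)).congr_of_eventuallyEq hev
  exact h.unique h0

/-- The covariant derivative of `ξ_{[α} ξ_{β;γ]} = 0`. -/
lemma deriv_hypersurfaceOrthogonal (hG : IsMetricOn U G) (hK : IsKillingOn U G u w) (hy : y ∈ U)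
    (h : ∀ z ∈ U, ∀ A B C : Idx → ℝ,
      lowerForm w z A * covDerivForm G w z B C
        - lowerForm w z B * covDerivForm G w z A C
        + lowerForm w z C * covDerivForm G w z A B = 0)
    (W A B C : Idx → ℝ) :
    covDerivForm G w y A W * covDerivForm G w y B C
        - lowerForm w y A * riemannForm G y (fun i ↦ u i y) W B C
      - (covDerivForm G w y B W * covDerivForm G w y A C
        - lowerForm w y B * riemannForm G y (fun i ↦ u i y) W A C)
      + (covDerivForm G w y C W * covDerivForm G w y A B
        - lowerForm w y C * riemannForm G y (fun i ↦ u i y) W A B) = 0 := by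
  obtain ⟨VA, rfl, hA⟩ := exists_hasCovDerivAlong_zero (fun i j k ↦ christoffel G i j k y) W A
  obtain ⟨VB, rfl, hB⟩ := exists_hasCovDerivAlong_zero (fun i j k ↦ christoffel G i j k y) W B
  obtain ⟨VC, rfl, hC⟩ := exists_hasCovDerivAlong_zero (fun i j k ↦ christoffel G i j k y) W C
  have l {V} := hasDerivAt_linForm_parallel hG hK hy (W := W) (V := V)
  have b {V Z} := hasDerivAt_bilForm_parallel hG hK hy (W := W) (V := V) (Z := Z)
  have hd := (((l hA).mul (b hB hC)).sub ((l hB).mul (b hA hC))).add ((l hC).mul (b hA hB))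
  have := eq_zero_of_hasDerivAt hG.isOpen h hy (W := W) (fun t ht ↦ ht (VA t) (VB t) (VC t)) hd
  simp only [line_zero] at this
  linarith

/-- The covariant derivative of `ξ_{[α} η_β ζ_{λ;ρ]} = 0`, evaluated on `A, B` and on `X, Y`
orthogonal to `ξ` and `η`, where `A, B` are dual to the covectors `ξ, η`. -/
lemma deriv_wedgeForm {u₃ w₃ : Idx → E4 → ℝ} (hG : IsMetricOn U G) (hK₁ : IsKillingOn U G u₁ w₁)
    (hK₂ : IsKillingOn U G u₂ w₂) (hK₃ : IsKillingOn U G u₃ w₃) (hy : y ∈ U)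
    (h : ∀ z ∈ U, ∀ A B C D : Idx → ℝ,
      wedgeForm (lowerForm w₁ z) (lowerForm w₂ z)
        (fun X Y ↦ covDerivForm G w₃ z X Y) A B C D = 0)
    {A B X Y : Idx → ℝ} (W : Idx → ℝ)
    (hA₁ : lowerForm w₁ y A = 1) (hA₂ : lowerForm w₂ y A = 0)
    (hB₁ : lowerForm w₁ y B = 0) (hB₂ : lowerForm w₂ y B = 1)
    (hX₁ : lowerForm w₁ y X = 0) (hX₂ : lowerForm w₂ y X = 0)
    (hY₁ : lowerForm w₁ y Y = 0) (hY₂ : lowerForm w₂ y Y = 0) :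
    riemannForm G y (fun i ↦ u₃ i y) W X Y
      = - covDerivForm G w₂ y X W * covDerivForm G w₃ y B Y
        + covDerivForm G w₂ y Y W * covDerivForm G w₃ y B X
        - covDerivForm G w₁ y X W * covDerivForm G w₃ y A Y
        + covDerivForm G w₁ y Y W * covDerivForm G w₃ y A X := by
  have hXY : covDerivForm G w₃ y X Y = 0 := by
    have := h y hy A B X Y
    simp only [wedgeForm, hA₁, hA₂, hB₁, hB₂, hX₁, hX₂, hY₁, hY₂] at this
    linarith
  obtain ⟨VA, rfl, hA⟩ := exists_hasCovDerivAlong_zero (fun i j k ↦ christoffel G i j k y) W A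
  obtain ⟨VB, rfl, hB⟩ := exists_hasCovDerivAlong_zero (fun i j k ↦ christoffel G i j k y) W B
  obtain ⟨VX, rfl, hX⟩ := exists_hasCovDerivAlong_zero (fun i j k ↦ christoffel G i j k y) W X
  obtain ⟨VY, rfl, hY⟩ := exists_hasCovDerivAlong_zero (fun i j k ↦ christoffel G i j k y) W Y
  have l₁ {V} := hasDerivAt_linForm_parallel hG hK₁ hy (W := W) (V := V)
  have l₂ {V} := hasDerivAt_linForm_parallel hG hK₂ hy (W := W) (V := V)
  have b {V Z} := hasDerivAt_bilForm_parallel hG hK₃ hy (W := W) (V := V) (Z := Z)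
  have m {V Z} (hV) (hZ) :=
    ((l₁ (V := V) hV).mul (l₂ (V := Z) hZ)).sub ((l₁ (V := Z) hZ).mul (l₂ (V := V) hV))
  have hd := ((((((m hA hB).mul (b hX hY)).sub ((m hA hX).mul (b hB hY))).add
    ((m hA hY).mul (b hB hX))).add ((m hB hX).mul (b hA hY))).sub
    ((m hB hY).mul (b hA hX))).add ((m hX hY).mul (b hA hB))
  have := eq_zero_of_hasDerivAt hG.isOpen h hy (W := W)
    (fun t ht ↦ ht (VA t) (VB t) (VX t) (VY t)) hd
  simp only [line_zero, Pi.mul_apply, Pi.sub_apply, hA₁, hA₂, hB₁, hB₂, hX₁, hX₂, hY₁, hY₂,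
    hXY] at this
  linarith

/-- `g(∇_W ξ, Z) = ξ_{i;j} Z^i W^j`. -/
lemma exists_hasCovDerivAlong_killing (hG : IsMetricOn U G) (hK : IsKillingOn U G u w)
    (hy : y ∈ U) (W : Idx → ℝ) :
    ∃ a : Idx → ℝ,
      HasCovDerivAlong (fun i j k ↦ christoffel G i j k y) W (fun t i ↦ u i (line y W t)) a ∧
      ∀ Z, metricForm G y a Z = covDerivForm G w y Z W := by
  have hd (i : Idx) := differentiableAt_of_contDiffOn hG.isOpen (hK.smooth_upper i) hy
  refine ⟨fun i ↦ ∑ k, (pd k (u i) y + ∑ j, christoffel G i j k y * u j y) * W k,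
    fun i ↦ ?_, fun Z ↦ ?_⟩
  · refine (hasDerivAt_comp_line (hd i) W).congr_deriv ?_
    simp only [line_zero, add_mul, Finset.sum_add_distrib, Finset.sum_mul]
    rw [Finset.sum_comm (f := fun j k ↦ christoffel G i j k y * (u j y * W k))]
    simp only [mul_assoc, add_sub_cancel_right]
  · simp only [bilForm_apply, hG.covDeriv_eq_sum hd hy hK.lower, Finset.sum_mul, Finset.mul_sum]
    calc _ = ∑ j, ∑ i, ∑ k, G i j y *
          ((pd k (u i) y + ∑ j, christoffel G i j k y * u j y) * W k * Z j) := Finset.sum_comm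
      _ = ∑ j, ∑ k, ∑ i, G i j y *
          ((pd k (u i) y + ∑ j, christoffel G i j k y * u j y) * W k * Z j) :=
          Finset.sum_congr rfl fun i _ ↦ Finset.sum_comm
      _ = _ := by
          refine Finset.sum_congr rfl fun i _ ↦ Finset.sum_congr rfl fun j _ ↦
            Finset.sum_congr rfl fun k _ ↦ ?_
          rw [hG.symm k i]
          ring

/-- Commuting Killing fields: `η_{i;j} ξ^j = ξ_{i;j} η^j`. -/
lemma bilForm_covDeriv_comm (hG : IsMetricOn U G) (hK₁ : IsKillingOn U G u₁ w₁)
    (hK₂ : IsKillingOn U G u₂ w₂) (hy : y ∈ U)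
    (hc : ∀ i, ∑ j, (u₁ j y * pd j (u₂ i) y - u₂ j y * pd j (u₁ i) y) = 0) (Z : Idx → ℝ) :
    covDerivForm G w₂ y Z (fun i ↦ u₁ i y)
      = covDerivForm G w₁ y Z (fun i ↦ u₂ i y) := by
  obtain ⟨a₁, h₁, hg₁⟩ := exists_hasCovDerivAlong_killing hG hK₁ hy (fun i ↦ u₂ i y)
  obtain ⟨a₂, h₂, hg₂⟩ := exists_hasCovDerivAlong_killing hG hK₂ hy (fun i ↦ u₁ i y)
  rw [← hg₁, ← hg₂]
  congr 2
  funext i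
  have e₁ := (h₁ i).unique (hasDerivAt_comp_line
    (differentiableAt_of_contDiffOn hG.isOpen (hK₁.smooth_upper i) hy) _)
  have e₂ := (h₂ i).unique (hasDerivAt_comp_line
    (differentiableAt_of_contDiffOn hG.isOpen (hK₂.smooth_upper i) hy) _)
  simp only [line_zero] at e₁ e₂
  have e₃ : ∑ j, ∑ k, christoffel G i j k y * (u₁ j y * u₂ k y)
      = ∑ j, ∑ k, christoffel G i j k y * (u₂ j y * u₁ k y) := by
    rw [Finset.sum_comm]
    refine Finset.sum_congr rfl fun j _ ↦ Finset.sum_congr rfl fun k _ ↦ ?_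
    rw [hG.christoffel_symm i k j]
    ring
  have e₄ := hc i
  simp only [Finset.sum_sub_distrib, mul_comm (u₁ _ y), mul_comm (u₂ _ y)] at e₄
  linarith

/-- The covariant derivative of the relation `η_{i;j} ξ^j = ξ_{i;j} η^j`. -/
lemma quadForm_of_comm (hG : IsMetricOn U G) (hK₁ : IsKillingOn U G u₁ w₁)
    (hK₂ : IsKillingOn U G u₂ w₂) (hy : y ∈ U)
    (hc : ∀ z ∈ U, ∀ i, ∑ j, (u₁ j z * pd j (u₂ i) z - u₂ j z * pd j (u₁ i) z) = 0)
    (W : Idx → ℝ) :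
    ∃ a₁ a₂ : Idx → ℝ,
      (∀ Z, metricForm G y a₁ Z = covDerivForm G w₁ y Z W) ∧
      (∀ Z, metricForm G y a₂ Z = covDerivForm G w₂ y Z W) ∧
      ∀ Z, -riemannForm G y (fun i ↦ u₂ i y) W Z (fun i ↦ u₁ i y) + covDerivForm G w₂ y Z a₁
          = -riemannForm G y (fun i ↦ u₁ i y) W Z (fun i ↦ u₂ i y)
            + covDerivForm G w₁ y Z a₂ := by
  obtain ⟨a₁, h₁, hg₁⟩ := exists_hasCovDerivAlong_killing hG hK₁ hy W
  obtain ⟨a₂, h₂, hg₂⟩ := exists_hasCovDerivAlong_killing hG hK₂ hy W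
  refine ⟨a₁, a₂, hg₁, hg₂, fun Z ↦ ?_⟩
  obtain ⟨V, rfl, hV⟩ := exists_hasCovDerivAlong_zero (fun i j k ↦ christoffel G i j k y) W Z
  have hd := (hasDerivAt_bilForm_covDeriv hG hK₂ hy hV h₁).sub
    (hasDerivAt_bilForm_covDeriv hG hK₁ hy hV h₂)
  have := eq_zero_of_hasDerivAt hG.isOpen (f := fun z ↦ z ∈ U) (fun z hz ↦ hz) hy (W := W)
    (fun t ht ↦ sub_eq_zero.2 (bilForm_covDeriv_comm hG hK₁ hK₂ ht (hc _ ht) (V t))) hd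
  simp only [line_zero, map_zero, LinearMap.zero_apply] at this
  linarith

end KillingFields

/-! ### The Bel tensor as a multilinear form -/

section Contractions

variable {N : Type*} [AddCommMonoid N] [Module ℝ N]

/-- The contraction `h^{ρρ'} c(M_ρ, N_ρ')` of the first slots of two multilinear maps with the
contravariant metric `h`, where the remaining slots are paired by `c`. -/
def contrLift (h : Idx → Idx → ℝ) (c : N →ₗ[ℝ] N →ₗ[ℝ] ℝ) :
    (Vec →ₗ[ℝ] N) →ₗ[ℝ] (Vec →ₗ[ℝ] N) →ₗ[ℝ] ℝ :=
  ∑ ρ, ∑ ρ', h ρ ρ' • c.compl₁₂ (LinearMap.applyₗ (Pi.single ρ (1 : ℝ) : Idx → ℝ))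
    (LinearMap.applyₗ (Pi.single ρ' (1 : ℝ) : Idx → ℝ))

lemma contrLift_apply (h : Idx → Idx → ℝ) (c : N →ₗ[ℝ] N →ₗ[ℝ] ℝ) (M L : Vec →ₗ[ℝ] N) :
    contrLift h c M L
      = ∑ ρ, ∑ ρ', h ρ ρ' * c (M (Pi.single ρ 1)) (L (Pi.single ρ' 1)) := by
  simp [contrLift]

/-- The full contraction of two linear forms. -/
def contrOne (h : Idx → Idx → ℝ) := contrLift h (LinearMap.mul ℝ ℝ)

/-- The full contraction of two bilinear forms. -/
def contrTwo (h : Idx → Idx → ℝ) := contrLift h (contrOne h)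

/-- The full contraction of two trilinear forms. -/
def contrThree (h : Idx → Idx → ℝ) := contrLift h (contrTwo h)

/-- The trilinear form `R(·, ·, C, ·)`. -/
def slotThree (R : Vec →ₗ[ℝ] Vec →ₗ[ℝ] Vec →ₗ[ℝ] Vec →ₗ[ℝ] ℝ) :
    Vec →ₗ[ℝ] Vec →ₗ[ℝ] Vec →ₗ[ℝ] Vec →ₗ[ℝ] ℝ :=
  (LinearMap.lflip.comp R).flip

@[simp] lemma slotThree_apply
    (R : Vec →ₗ[ℝ] Vec →ₗ[ℝ] Vec →ₗ[ℝ] Vec →ₗ[ℝ] ℝ)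
    (A B C D : Idx → ℝ) : slotThree R C A B D = R A B C D := rfl

/-- The Bel tensor as a function of four vectors. -/
def belForm (g : Vec →ₗ[ℝ] Vec →ₗ[ℝ] ℝ) (h : Idx → Idx → ℝ)
    (R : Vec →ₗ[ℝ] Vec →ₗ[ℝ] Vec →ₗ[ℝ] Vec →ₗ[ℝ] ℝ)
    (A B C X : Idx → ℝ) : ℝ :=
  contrTwo h ((R A).flip C) ((R B).flip X) + contrTwo h ((R A).flip X) ((R B).flip C)
    - (1 / 2) * g A B * contrThree h (slotThree R C) (slotThree R X)
    - (1 / 2) * g C X * contrThree h (R A) (R B)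
    + (1 / 8) * g A B * g C X *
      ∑ ρ, ∑ ρ', h ρ ρ' * contrThree h (R (Pi.single ρ 1)) (R (Pi.single ρ' 1))

lemma belOf_eq_belForm (g h : Idx → Idx → ℝ) (R : Idx → Idx → Idx → Idx → ℝ) (α β l μ : Idx) :
    belOf g h R α β l μ = belForm (bilForm g) h (quadForm R) (Pi.single α 1) (Pi.single β 1)
      (Pi.single l 1) (Pi.single μ 1) := by
  simp only [belOf, belForm, contrThree, contrTwo, contrOne, contrLift_apply,
    LinearMap.mul_apply', LinearMap.flip_apply, slotThree_apply, quadForm_single, bilForm_single,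
    Finset.mul_sum, mul_assoc]

/-- A linear function is the sum of its values on the standard basis times the coordinates. -/
lemma sum_linear {φ : Vec → ℝ} (hadd : ∀ v z, φ (v + z) = φ v + φ z)
    (hsmul : ∀ (c : ℝ) v, φ (c • v) = c * φ v) (v : Idx → ℝ) :
    ∑ i, φ (Pi.single i 1) * v i = φ v := by
  let L : Vec →ₗ[ℝ] ℝ := { toFun := φ, map_add' := hadd, map_smul' := by simpa using hsmul }
  have h := L.pi_apply_eq_sum_univ v
  simp only [smul_eq_mul] at h
  refine Eq.trans ?_ h.symm
  refine Finset.sum_congr rfl fun i _ ↦ ?_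
  rw [mul_comm]
  congr 2
  funext j
  simp [Pi.single_apply, eq_comm]

variable {g : Vec →ₗ[ℝ] Vec →ₗ[ℝ] ℝ} {h : Idx → Idx → ℝ}

/-- `h` is the contravariant form of the nondegenerate metric `g`: the vector `h^{ρ·}` represents
the coordinate function `v ↦ v^ρ`. -/
def IsCometric (g : Vec →ₗ[ℝ] Vec →ₗ[ℝ] ℝ) (h : Idx → Idx → ℝ) : Prop :=
  (∀ v w, g v w = g w v) ∧ ∀ ρ v, g (h ρ) v = v ρ

lemma sum_smul_single (v : Idx → ℝ) : v = ∑ i, v i • (Pi.single i 1 : Idx → ℝ) := by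
  ext j
  simp [Finset.sum_apply, Pi.single_apply]

lemma IsCometric.eq_zero (hh : IsCometric g h) {v : Idx → ℝ} (hv : ∀ w, g v w = 0) : v = 0 := by
  funext ρ
  rw [← hh.2 ρ v, hh.1, hv]
  rfl

/-- The contraction with one contravariant metric absorbed into the second argument: the vectors
`h^{ρ·}` form the basis reciprocal to the standard one. -/
lemma contrLift_eq_sum (c : N →ₗ[ℝ] N →ₗ[ℝ] ℝ) (M L : Vec →ₗ[ℝ] N) :
    contrLift h c M L = ∑ ρ, c (M (Pi.single ρ 1)) (L (h ρ)) := by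
  rw [contrLift_apply]
  refine Finset.sum_congr rfl fun ρ _ ↦ ?_
  conv_rhs => rw [sum_smul_single (h ρ)]
  simp

/-- The contraction is invariant under isometric involutions. -/
lemma contrLift_isometry (hh : IsCometric g h) {s : Vec →ₗ[ℝ] Vec}
    (hs : ∀ v w, g (s v) w = g v (s w)) (hss : ∀ v, s (s v) = v)
    (c : N →ₗ[ℝ] N →ₗ[ℝ] ℝ) (M L : Vec →ₗ[ℝ] N) :
    contrLift h c (M ∘ₗ s) (L ∘ₗ s) = contrLift h c M L := by
  simp only [contrLift_eq_sum, LinearMap.comp_apply]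
  have hd (ρ : Idx) : s (h ρ) = ∑ τ, (s (Pi.single τ 1) : Idx → ℝ) ρ • h τ := by
    refine sub_eq_zero.1 (hh.eq_zero fun v ↦ ?_)
    have e : s v = ∑ τ, v τ • s (Pi.single τ 1) := by
      conv_lhs => rw [sum_smul_single v, map_sum]
      simp
    simp only [map_sub, map_sum, map_smul, LinearMap.sub_apply, LinearMap.sum_apply,
      LinearMap.smul_apply, hs, hh.2, smul_eq_mul]
    rw [e]
    simp [Finset.sum_apply, mul_comm]
  simp only [hd, map_sum, map_smul, smul_eq_mul]
  rw [Finset.sum_comm]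
  refine Finset.sum_congr rfl fun τ _ ↦ ?_
  conv_rhs => rw [← hss (Pi.single τ 1), sum_smul_single (s (Pi.single τ 1))]
  simp

section Reflection

variable {s : Vec →ₗ[ℝ] Vec}
  {R : Vec →ₗ[ℝ] Vec →ₗ[ℝ] Vec →ₗ[ℝ] Vec →ₗ[ℝ] ℝ}

lemma contrTwo_isometry (hh : IsCometric g h) (hs : ∀ v w, g (s v) w = g v (s w))
    (hss : ∀ v, s (s v) = v) {M M' L L' : Vec →ₗ[ℝ] Vec →ₗ[ℝ] ℝ}
    (hM : ∀ u v, M' u v = M (s u) (s v)) (hL : ∀ u v, L' u v = L (s u) (s v)) :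
    contrTwo h M' L' = contrTwo h M L := by
  rw [contrTwo, ← contrLift_isometry hh hs hss _ M L, contrLift_apply, contrLift_apply]
  refine Finset.sum_congr rfl fun ρ _ ↦ Finset.sum_congr rfl fun ρ' _ ↦ ?_
  have eM : M' (Pi.single ρ 1) = M (s (Pi.single ρ 1)) ∘ₗ s := LinearMap.ext fun v ↦ hM _ v
  have eL : L' (Pi.single ρ' 1) = L (s (Pi.single ρ' 1)) ∘ₗ s := LinearMap.ext fun v ↦ hL _ v
  rw [eM, eL, contrOne, contrLift_isometry hh hs hss]
  rfl

lemma contrThree_isometry (hh : IsCometric g h) (hs : ∀ v w, g (s v) w = g v (s w))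
    (hss : ∀ v, s (s v) = v) {M M' L L' : Vec →ₗ[ℝ] Vec →ₗ[ℝ] Vec →ₗ[ℝ] ℝ}
    (hM : ∀ u v w, M' u v w = M (s u) (s v) (s w))
    (hL : ∀ u v w, L' u v w = L (s u) (s v) (s w)) :
    contrThree h M' L' = contrThree h M L := by
  rw [contrThree, ← contrLift_isometry hh hs hss _ M L, contrLift_apply, contrLift_apply]
  refine Finset.sum_congr rfl fun ρ _ ↦ Finset.sum_congr rfl fun ρ' _ ↦ ?_
  rw [contrTwo_isometry hh hs hss (fun u v ↦ hM _ u v) (fun u v ↦ hL _ u v)]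
  rfl

/-- If an isometric involution preserves the curvature, the Bel tensor vanishes on three vectors
that it fixes and one that it reverses. -/
lemma belForm_eq_zero_of_reflection (hh : IsCometric g h) (hs : ∀ v w, g (s v) w = g v (s w))
    (hss : ∀ v, s (s v) = v) (hR : ∀ u v w z, R (s u) (s v) (s w) (s z) = R u v w z)
    {A B C X : Idx → ℝ} (hA : s A = A) (hB : s B = B) (hC : s C = C) (hX : s X = -X) :
    belForm g h R A B C X = 0 := by
  -- The contraction of an even with an odd form vanishes.
  have hz {M L : Vec →ₗ[ℝ] Vec →ₗ[ℝ] ℝ} (hM : ∀ u v, M (s u) (s v) = M u v)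
      (hL : ∀ u v, L (s u) (s v) = -L u v) : contrTwo h M L = 0 := by
    have h1 : contrTwo h M ((-1 : ℝ) • L) = contrTwo h M L :=
      contrTwo_isometry hh hs hss (fun u v ↦ (hM u v).symm) fun u v ↦ by simp [hL]
    rw [map_smul, smul_eq_mul] at h1
    linarith
  have hz3 {M L : Vec →ₗ[ℝ] Vec →ₗ[ℝ] Vec →ₗ[ℝ] ℝ}
      (hM : ∀ u v w, M (s u) (s v) (s w) = M u v w)
      (hL : ∀ u v w, L (s u) (s v) (s w) = -L u v w) : contrThree h M L = 0 := by
    have h1 : contrThree h M ((-1 : ℝ) • L) = contrThree h M L :=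
      contrThree_isometry hh hs hss (fun u v w ↦ (hM u v w).symm) fun u v w ↦ by simp [hL]
    rw [map_smul, smul_eq_mul] at h1
    linarith
  have even {D E : Idx → ℝ} (hD : s D = D) (hE : s E = E) (u v : Idx → ℝ) :
      (R D).flip E (s u) (s v) = (R D).flip E u v := by
    have := hR D u E v
    rwa [hD, hE] at this
  have odd {D : Idx → ℝ} (hD : s D = D) (u v : Idx → ℝ) :
      (R D).flip X (s u) (s v) = -(R D).flip X u v := by
    have := hR D u X v
    rw [hD, hX] at this
    simp only [LinearMap.flip_apply, map_neg, LinearMap.neg_apply] at this ⊢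
    linarith
  have hgCX : g C X = 0 := by
    have := hs C X
    rw [hC, hX, map_neg] at this
    linarith
  rw [belForm, hz (even hA hC) (odd hB), hgCX, hz3 (M := slotThree R C) (L := slotThree R X)]
  · have h1 : contrTwo h ((R A).flip X) ((R B).flip C) = 0 := by
      have := contrTwo_isometry hh hs hss (M' := (R A).flip X) (L' := (R B).flip C)
        (M := (-1 : ℝ) • (R A).flip X) (L := (R B).flip C)
        (fun u v ↦ by
          simp only [LinearMap.smul_apply, odd hA, smul_eq_mul]; ring)
        (fun u v ↦ (even hB hC u v).symm)
      rw [map_smul, LinearMap.smul_apply, smul_eq_mul] at this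
      linarith
    rw [h1]
    ring
  · intro u v w
    have := hR u v C w
    rwa [hC] at this
  · intro u v w
    have := hR u v X w
    rw [hX] at this
    simp only [slotThree_apply, map_neg, LinearMap.neg_apply] at this ⊢
    linarith

end Reflection

section NullFrame

/-- A basis `e, k, f, l` with `e, f` non-null, `k, l` null, `g(k, l) = 1` and all other products
zero; the last condition is the resulting expansion of a vector. -/
structure IsNullFrame (g : Vec →ₗ[ℝ] Vec →ₗ[ℝ] ℝ) (e k f l : Idx → ℝ) : Prop where
  ee : g e e ≠ 0
  ek : g e k = 0
  ef : g e f = 0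
  el : g e l = 0
  kk : g k k = 0
  kf : g k f = 0
  kl : g k l = 1
  ff : g f f ≠ 0
  fl : g f l = 0
  ll : g l l = 0
  expand (v : Idx → ℝ) : v = (g v e / g e e) • e + (g v f / g f f) • f + g v l • k + g v k • l

/-- The contraction computed in a null frame. -/
lemma contrLift_nullFrame (hh : IsCometric g h) {e k f l : Idx → ℝ} (hF : IsNullFrame g e k f l)
    (c : N →ₗ[ℝ] N →ₗ[ℝ] ℝ) (M L : Vec →ₗ[ℝ] N) :
    contrLift h c M L = c (M e) (L e) / g e e + c (M f) (L f) / g f f + c (M k) (L l)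
      + c (M l) (L k) := by
  have hd (ρ : Idx) : h ρ = (e ρ / g e e) • e + (f ρ / g f f) • f + l ρ • k + k ρ • l := by
    conv_lhs => rw [hF.expand (h ρ)]
    simp only [hh.2]
  have hs (v w : Idx → ℝ) : c (M v) (L w) = ∑ ρ, v ρ * c (M (Pi.single ρ 1)) (L w) := by
    conv_lhs => rw [sum_smul_single v]
    simp
  rw [contrLift_eq_sum, hs e e, hs f f, hs k l, hs l k, Finset.sum_div, Finset.sum_div,
    ← Finset.sum_add_distrib, ← Finset.sum_add_distrib, ← Finset.sum_add_distrib]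
  refine Finset.sum_congr rfl fun ρ _ ↦ ?_
  rw [hd]
  simp only [map_add, map_smul, smul_eq_mul]
  ring

end NullFrame

end Contractions

/-! ### Nondegenerate orbits -/

section OrbitAlgebra

/-- The algebraic symmetries of a Riemann tensor. -/
structure IsCurvatureForm (R : Vec →ₗ[ℝ] Vec →ₗ[ℝ] Vec →ₗ[ℝ] Vec →ₗ[ℝ] ℝ) : Prop where
  swap_left (u v w z : Vec) : R u v w z = -R v u w z
  swap_right (u v w z : Vec) : R u v w z = -R u v z w
  pair (u v w z : Vec) : R u v w z = R w z u v
  cyclic (u v w z : Vec) : R u v w z + R u w z v + R u z v w = 0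

variable {g F₁ F₂ : Vec →ₗ[ℝ] Vec →ₗ[ℝ] ℝ} {h : Idx → Idx → ℝ}
  {R : Vec →ₗ[ℝ] Vec →ₗ[ℝ] Vec →ₗ[ℝ] Vec →ₗ[ℝ] ℝ} {ξ η : Vec}

lemma IsCurvatureForm.self_left (hR : IsCurvatureForm R) (u w z : Vec) : R u u w z = 0 := by
  linarith [hR.swap_left u u w z]

lemma IsCurvatureForm.self_right (hR : IsCurvatureForm R) (u w z : Vec) : R w z u u = 0 := by
  linarith [hR.swap_right w z u u]

lemma quad_sub (R : Vec →ₗ[ℝ] Vec →ₗ[ℝ] Vec →ₗ[ℝ] Vec →ₗ[ℝ] ℝ) (u u' v w z : Vec) :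
    R (u - u') v w z = R u v w z - R u' v w z := by
  have e : R u = R (u - u') + R u' := by rw [← map_add, sub_add_cancel]
  rw [e]
  simp

/-- If `p` is a projection with orthogonal kernel and the curvature has no components with an odd
number of arguments in the image, the Bel tensor has none with three arguments in the image. -/
lemma belForm_eq_zero_of_projection (hh : IsCometric g h) (hR : IsCurvatureForm R)
    {p : Vec →ₗ[ℝ] Vec} (hp : ∀ v w, g (p v) (w - p w) = 0)
    (h₃ : ∀ u v w z, R (p u) (p v) (p w) (z - p z) = 0)
    (h₁ : ∀ u v w z, R (p u) (v - p v) (w - p w) (z - p z) = 0)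
    {A B C X : Vec} (hA : p A = A) (hB : p B = B) (hC : p C = C) (hX : p X = 0) :
    belForm g h R A B C X = 0 := by
  have hpp (v : Vec) : p (p v) = p v := by
    refine (sub_eq_zero.1 (hh.eq_zero fun w ↦ ?_)).symm
    have e1 := hp (v - p v) w
    have e2 := hp w (p v)
    rw [hh.1] at e2
    simp only [map_sub, LinearMap.sub_apply] at e1 e2 ⊢
    linarith
  -- The reflection that fixes the image of `p` and reverses its kernel.
  let s : Vec →ₗ[ℝ] Vec := p - (LinearMap.id - p)
  have hs_apply (v : Vec) : s v = p v - (v - p v) := rfl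
  refine belForm_eq_zero_of_reflection (s := s) hh (fun v w ↦ ?_) (fun v ↦ ?_)
    (fun u v w z ↦ ?_) ?_ ?_ ?_ ?_
  · have e1 := hp v w
    have e2 := hp w v
    rw [hh.1] at e2
    rw [hs_apply, hs_apply]
    simp only [map_sub, LinearMap.sub_apply] at e1 e2 ⊢
    linarith
  · simp only [hs_apply, map_sub, hpp]
    abel
  · have hu (u : Vec) : u = p u + (u - p u) := by abel
    rw [hs_apply u, hs_apply v, hs_apply w, hs_apply z]
    conv_rhs => rw [hu u, hu v, hu w, hu z]
    have a1 := h₃ u v w z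
    have a2 := h₃ u v z w
    rw [hR.swap_right] at a2
    have a3 := h₃ w z u v
    rw [hR.pair] at a3
    have a4 := h₃ w z v u
    rw [hR.pair, hR.swap_left] at a4
    have b1 := h₁ u v w z
    have b2 := h₁ v u w z
    rw [hR.swap_left] at b2
    have b3 := h₁ w z u v
    rw [hR.pair] at b3
    have b4 := h₁ z w u v
    rw [hR.pair, hR.swap_right] at b4
    generalize u - p u = u' at *
    generalize v - p v = v' at *
    generalize w - p w = w' at *
    generalize z - p z = z' at *
    simp only [quad_sub, map_add, map_sub, LinearMap.add_apply, LinearMap.sub_apply]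
    linarith
  · rw [hs_apply, hA, sub_self, sub_zero]
  · rw [hs_apply, hB, sub_self, sub_zero]
  · rw [hs_apply, hC, sub_self, sub_zero]
  · rw [hs_apply, hX, sub_zero, zero_sub]

/-- The case of a single non-null hypersurface-orthogonal Killing field: `hw` is the condition
`ξ_{[α} F_{βγ]} = 0` and `hd` its covariant derivative in direction `W`. -/
lemma belForm_eq_zero_of_hypersurfaceOrthogonal (hh : IsCometric g h) (hR : IsCurvatureForm R)
    (hξ : g ξ ξ ≠ 0) {F : Vec →ₗ[ℝ] Vec →ₗ[ℝ] ℝ}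
    (hw : ∀ A B C, g ξ A * F B C - g ξ B * F A C + g ξ C * F A B = 0)
    (hd : ∀ W A B C, F A W * F B C - g ξ A * R ξ W B C - (F B W * F A C - g ξ B * R ξ W A C)
      + (F C W * F A B - g ξ C * R ξ W A B) = 0)
    {X : Vec} (hX : g ξ X = 0) : belForm g h R ξ ξ ξ X = 0 := by
  -- `ξ` and an arbitrary vector, contracted with two vectors orthogonal to `ξ`: the derivative of
  -- the condition gives a term quadratic in `F`, which the condition itself annihilates.
  have key (W : Vec) {B C : Vec} (hB : g ξ B = 0) (hC : g ξ C = 0) : R ξ W B C = 0 := by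
    have e1 := hw ξ B C
    have e2 := hw ξ B W
    have e3 := hw ξ C W
    have e4 := hd W ξ B C
    rw [hB, hC] at e1 e4
    rw [hB] at e2
    rw [hC] at e3
    have f1 : F B C = 0 := by
      have : g ξ ξ * F B C = 0 := by linarith
      exact (mul_eq_zero.1 this).resolve_left hξ
    have f2 : g ξ ξ * (g ξ ξ * R ξ W B C) = 0 := by
      rw [f1] at e4
      linear_combination (-g ξ ξ) * e4 - F ξ C * e2 + F ξ B * e3
    simpa [hξ] using f2
  -- The orthogonal projection onto the line spanned by `ξ`.
  let p : Vec →ₗ[ℝ] Vec := (g ξ).smulRight ((g ξ ξ)⁻¹ • ξ)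
  have hp_apply (v : Vec) : p v = (g ξ v / g ξ ξ) • ξ := by
    simp [p, smul_smul, div_eq_mul_inv]
  have hperp (v : Vec) : g ξ (v - p v) = 0 := by
    rw [hp_apply, map_sub, map_smul, smul_eq_mul]
    field_simp
    ring
  have hpξ : p ξ = ξ := by rw [hp_apply, div_self hξ, one_smul]
  refine belForm_eq_zero_of_projection (p := p) hh hR (fun v w ↦ ?_) (fun u v w z ↦ ?_)
    (fun u v w z ↦ ?_) hpξ hpξ hpξ ?_
  · rw [hp_apply v, map_smul, LinearMap.smul_apply, hperp, smul_zero]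
  · rw [hp_apply u, hp_apply v]
    simp only [map_smul, LinearMap.smul_apply, hR.self_left, smul_zero]
  · rw [hp_apply u]
    simp only [map_smul, LinearMap.smul_apply, key _ (hperp w) (hperp z), smul_zero]
  · rw [hp_apply, hX, zero_div, zero_smul]

/-- The data at a point of an abelian two-parameter group of isometries acting orthogonally
transitively: the Killing vectors `ξ, η`, their covariant derivatives `F₁, F₂` and the curvature
`R`. -/
structure IsOrbitData (g F₁ F₂ : Vec →ₗ[ℝ] Vec →ₗ[ℝ] ℝ)
    (R : Vec →ₗ[ℝ] Vec →ₗ[ℝ] Vec →ₗ[ℝ] Vec →ₗ[ℝ] ℝ) (ξ η : Vec) : Prop where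
  curv : IsCurvatureForm R
  anti₁ (v w : Vec) : F₁ v w = -F₁ w v
  anti₂ (v w : Vec) : F₂ v w = -F₂ w v
  /-- `∇_ξ η = ∇_η ξ`. -/
  comm (Z : Vec) : F₂ Z ξ = F₁ Z η
  /-- The covariant derivative of `∇_ξ η = ∇_η ξ`; here `a = ∇_W ξ` and `b = ∇_W η`. -/
  curv_comm (W : Vec) : ∃ a b : Vec, (∀ Z, g a Z = F₁ Z W) ∧ (∀ Z, g b Z = F₂ Z W) ∧
    ∀ Z, R ξ η W Z = F₂ Z a - F₁ Z b
  /-- `ξ_{[α} η_β ξ_{λ;ρ]} = 0`. -/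
  orth₁ {X Y : Vec} (hX₁ : g ξ X = 0) (hX₂ : g η X = 0) (hY₁ : g ξ Y = 0) (hY₂ : g η Y = 0) :
    F₁ X Y = 0
  /-- `ξ_{[α} η_β η_{λ;ρ]} = 0`. -/
  orth₂ {X Y : Vec} (hX₁ : g ξ X = 0) (hX₂ : g η X = 0) (hY₁ : g ξ Y = 0) (hY₂ : g η Y = 0) :
    F₂ X Y = 0
  /-- The covariant derivative of `ξ_{[α} η_β ξ_{λ;ρ]} = 0`. -/
  curv_orth₁ {A B X Y : Vec} (W : Vec) (hA₁ : g ξ A = 1) (hA₂ : g η A = 0) (hB₁ : g ξ B = 0)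
    (hB₂ : g η B = 1) (hX₁ : g ξ X = 0) (hX₂ : g η X = 0) (hY₁ : g ξ Y = 0) (hY₂ : g η Y = 0) :
    R ξ W X Y = -F₂ X W * F₁ B Y + F₂ Y W * F₁ B X - F₁ X W * F₁ A Y + F₁ Y W * F₁ A X
  /-- The covariant derivative of `ξ_{[α} η_β η_{λ;ρ]} = 0`. -/
  curv_orth₂ {A B X Y : Vec} (W : Vec) (hA₁ : g ξ A = 1) (hA₂ : g η A = 0) (hB₁ : g ξ B = 0)
    (hB₂ : g η B = 1) (hX₁ : g ξ X = 0) (hX₂ : g η X = 0) (hY₁ : g ξ Y = 0) (hY₂ : g η Y = 0) :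
    R η W X Y = -F₂ X W * F₂ B Y + F₂ Y W * F₂ B X - F₁ X W * F₂ A Y + F₁ Y W * F₂ A X

namespace IsOrbitData

/-- Orbit data for a different basis `ξ, η - t ξ` of the Lie algebra of the group. -/
lemma sub_smul (hD : IsOrbitData g F₁ F₂ R ξ η) (t : ℝ) :
    IsOrbitData g F₁ (F₂ - t • F₁) R ξ (η - t • ξ) where
  curv := hD.curv
  anti₁ := hD.anti₁
  anti₂ v w := by
    simp only [LinearMap.sub_apply, LinearMap.smul_apply, smul_eq_mul, hD.anti₁ v w, hD.anti₂ v w]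
    ring
  comm Z := by
    simp only [LinearMap.sub_apply, LinearMap.smul_apply, map_sub, map_smul, hD.comm]
  curv_comm W := by
    obtain ⟨a, b, ha, hb, hab⟩ := hD.curv_comm W
    refine ⟨a, b - t • a, ha, fun Z ↦ ?_, fun Z ↦ ?_⟩
    · simp [ha, hb]
    · simp only [LinearMap.sub_apply, LinearMap.smul_apply, map_sub, map_smul, hab,
        hD.curv.self_left, smul_eq_mul]
      ring
  orth₁ hX₁ hX₂ hY₁ hY₂ := by
    simp only [map_sub, map_smul, LinearMap.sub_apply, LinearMap.smul_apply, hX₁, hY₁, smul_zero,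
      sub_zero] at hX₂ hY₂
    exact hD.orth₁ hX₁ hX₂ hY₁ hY₂
  orth₂ hX₁ hX₂ hY₁ hY₂ := by
    simp only [map_sub, map_smul, LinearMap.sub_apply, LinearMap.smul_apply, hX₁, hY₁, smul_zero,
      sub_zero] at hX₂ hY₂ ⊢
    rw [hD.orth₁ hX₁ hX₂ hY₁ hY₂, hD.orth₂ hX₁ hX₂ hY₁ hY₂, smul_zero, sub_zero]
  curv_orth₁ {A B X Y} W hA₁ hA₂ hB₁ hB₂ hX₁ hX₂ hY₁ hY₂ := by
    simp only [map_sub, map_smul, LinearMap.sub_apply, LinearMap.smul_apply, hX₁, hY₁, hA₁, hB₁,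
      smul_eq_mul, mul_zero, mul_one, sub_zero] at hA₂ hB₂ hX₂ hY₂ ⊢
    rw [hD.curv_orth₁ (A := A - t • B) (B := B) W (by simp [hA₁, hB₁])
      (by simp only [map_sub, map_smul, hB₂, smul_eq_mul]; linarith) hB₁ hB₂ hX₁ hX₂ hY₁ hY₂]
    simp only [map_sub, map_smul, LinearMap.sub_apply, LinearMap.smul_apply, smul_eq_mul]
    ring
  curv_orth₂ {A B X Y} W hA₁ hA₂ hB₁ hB₂ hX₁ hX₂ hY₁ hY₂ := by
    simp only [map_sub, map_smul, LinearMap.sub_apply, LinearMap.smul_apply, hX₁, hY₁, hA₁, hB₁,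
      smul_eq_mul, mul_zero, mul_one, sub_zero] at hA₂ hB₂ hX₂ hY₂ ⊢
    rw [quad_sub]
    simp only [map_smul, LinearMap.smul_apply, smul_eq_mul]
    have hA' : g ξ (A - t • B) = 1 := by simp [hA₁, hB₁]
    have hA'' : g η (A - t • B) = 0 := by
      simp only [map_sub, map_smul, hB₂, smul_eq_mul]; linarith
    rw [hD.curv_orth₁ (A := A - t • B) (B := B) W hA' hA'' hB₁ hB₂ hX₁ hX₂ hY₁ hY₂,
      hD.curv_orth₂ (A := A - t • B) (B := B) W hA' hA'' hB₁ hB₂ hX₁ hX₂ hY₁ hY₂]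
    simp only [map_sub, map_smul, LinearMap.sub_apply, LinearMap.smul_apply, smul_eq_mul]
    ring

lemma F₁_ξ_η (hD : IsOrbitData g F₁ F₂ R ξ η) : F₁ ξ η = 0 := by
  linarith [hD.comm ξ, hD.anti₂ ξ ξ]

lemma F₂_ξ_η (hD : IsOrbitData g F₁ F₂ R ξ η) : F₂ ξ η = 0 := by
  linarith [hD.comm η, hD.anti₁ η η, hD.anti₂ ξ η]

/-- The curvature vanishes on three vectors tangent to the orbit and one orthogonal to it. -/
lemma curv_tangent (hD : IsOrbitData g F₁ F₂ R ξ η) (a b : ℝ) {X : Vec} (hX₁ : g ξ X = 0)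
    (hX₂ : g η X = 0) (hg : ∀ v w, g v w = g w v) : R ξ η (a • ξ + b • η) X = 0 := by
  -- For a tangent direction, `∇ξ` and `∇η` are orthogonal to the orbit: the group is abelian and
  -- its orbits have constant metric.
  obtain ⟨u, v, hu, hv, huv⟩ := hD.curv_comm (a • ξ + b • η)
  have e₁ : F₁ ξ ξ = 0 := by linarith [hD.anti₁ ξ ξ]
  have e₂ : F₂ η η = 0 := by linarith [hD.anti₂ η η]
  have e₃ : F₂ ξ ξ = 0 := by linarith [hD.anti₂ ξ ξ]
  have e₄ : F₁ η η = 0 := by linarith [hD.anti₁ η η]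
  have e₅ := hD.F₁_ξ_η
  have e₆ := hD.F₂_ξ_η
  have e₇ : F₁ η ξ = 0 := by linarith [hD.anti₁ ξ η]
  have e₈ : F₂ η ξ = 0 := by linarith [hD.anti₂ ξ η]
  have u₁ : g ξ u = 0 := by rw [hg, hu]; simp [e₁, e₅]
  have u₂ : g η u = 0 := by rw [hg, hu]; simp [e₇, e₄]
  have v₁ : g ξ v = 0 := by rw [hg, hv]; simp [e₃, e₆]
  have v₂ : g η v = 0 := by rw [hg, hv]; simp [e₈, e₂]
  rw [huv, hD.orth₂ hX₁ hX₂ u₁ u₂, hD.orth₁ hX₁ hX₂ v₁ v₂, sub_zero]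

/-- The curvature vanishes on one vector tangent to the orbit and three orthogonal to it. -/
lemma curv_normal (hD : IsOrbitData g F₁ F₂ R ξ η)
    {A B : Vec} (hA₁ : g ξ A = 1) (hA₂ : g η A = 0) (hB₁ : g ξ B = 0) (hB₂ : g η B = 1)
    {X Y Z : Vec} (hX₁ : g ξ X = 0) (hX₂ : g η X = 0) (hY₁ : g ξ Y = 0) (hY₂ : g η Y = 0)
    (hZ₁ : g ξ Z = 0) (hZ₂ : g η Z = 0) : R ξ Z X Y = 0 ∧ R η Z X Y = 0 := by
  rw [hD.curv_orth₁ Z hA₁ hA₂ hB₁ hB₂ hX₁ hX₂ hY₁ hY₂,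
    hD.curv_orth₂ Z hA₁ hA₂ hB₁ hB₂ hX₁ hX₂ hY₁ hY₂, hD.orth₁ hX₁ hX₂ hZ₁ hZ₂,
    hD.orth₁ hY₁ hY₂ hZ₁ hZ₂, hD.orth₂ hX₁ hX₂ hZ₁ hZ₂, hD.orth₂ hY₁ hY₂ hZ₁ hZ₂]
  simp

/-- The Bel tensor at a point where the orbit is not a null surface. -/
lemma belForm_eq_zero_of_nondegenerate (hh : IsCometric g h) (hD : IsOrbitData g F₁ F₂ R ξ η)
    (hdet : g ξ ξ * g η η - g ξ η ^ 2 ≠ 0) {A B C X : Vec}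
    (hA : ∃ a b : ℝ, A = a • ξ + b • η) (hB : ∃ a b : ℝ, B = a • ξ + b • η)
    (hC : ∃ a b : ℝ, C = a • ξ + b • η) (hX₁ : g ξ X = 0) (hX₂ : g η X = 0) :
    belForm g h R A B C X = 0 := by
  set Δ := g ξ ξ * g η η - g ξ η ^ 2 with hΔ
  -- `A'` and `B'` span the orbit and are dual to the covectors `ξ` and `η`.
  set A' : Vec := (g η η / Δ) • ξ - (g ξ η / Δ) • η with hA'
  set B' : Vec := (g ξ ξ / Δ) • η - (g ξ η / Δ) • ξ with hB'
  have dA₁ : g ξ A' = 1 := by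
    simp only [hA', map_sub, map_smul, smul_eq_mul]
    field_simp
    rw [hΔ]; ring
  have dA₂ : g η A' = 0 := by
    simp only [hA', map_sub, map_smul, smul_eq_mul, hh.1 η ξ]
    field_simp
    ring
  have dB₁ : g ξ B' = 0 := by
    simp only [hB', map_sub, map_smul, smul_eq_mul]
    field_simp
    ring
  have dB₂ : g η B' = 1 := by
    simp only [hB', map_sub, map_smul, smul_eq_mul, hh.1 η ξ]
    field_simp
    rw [hΔ]
  -- The orthogonal projection onto the tangent plane of the orbit.
  let p : Vec →ₗ[ℝ] Vec := (g A').smulRight ξ + (g B').smulRight η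
  have hp_apply (v : Vec) : p v = g A' v • ξ + g B' v • η := rfl
  have hp₁ (v : Vec) : g ξ (v - p v) = 0 := by
    rw [hp_apply]
    simp only [map_sub, map_add, map_smul, smul_eq_mul, hA', hB', LinearMap.sub_apply,
      LinearMap.smul_apply]
    field_simp
    rw [hΔ]; ring
  have hp₂ (v : Vec) : g η (v - p v) = 0 := by
    rw [hp_apply]
    simp only [map_sub, map_add, map_smul, smul_eq_mul, hA', hB', LinearMap.sub_apply,
      LinearMap.smul_apply, hh.1 η ξ]
    field_simp
    rw [hΔ]; ring
  have hpξ : p ξ = ξ := by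
    rw [hp_apply, hh.1, dA₁, hh.1, dB₁]
    simp
  have hpη : p η = η := by
    rw [hp_apply, hh.1, dA₂, hh.1, dB₂]
    simp
  have hpP {v : Vec} : (∃ a b : ℝ, v = a • ξ + b • η) → p v = v := by
    rintro ⟨a, b, rfl⟩
    rw [map_add, map_smul, map_smul, hpξ, hpη]
  refine belForm_eq_zero_of_projection (p := p) hh hD.curv (fun v w ↦ ?_) (fun u v w z ↦ ?_)
    (fun u v w z ↦ ?_) (hpP hA) (hpP hB) (hpP hC) ?_
  · rw [hp_apply v]
    simp only [map_add, map_smul, LinearMap.add_apply, LinearMap.smul_apply, hp₁, hp₂, smul_zero,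
      add_zero]
  · have e := hD.curv_tangent (g A' w) (g B' w) (hp₁ z) (hp₂ z) hh.1
    rw [← hp_apply] at e
    have e' := hD.curv.swap_left η ξ (p w) (z - p z)
    rw [e, neg_zero] at e'
    rw [hp_apply u, hp_apply v]
    simp only [map_add, map_smul, LinearMap.add_apply, LinearMap.smul_apply,
      hD.curv.self_left, e, e', smul_zero, add_zero]
  · have e := hD.curv_normal dA₁ dA₂ dB₁ dB₂ (hp₁ w) (hp₂ w) (hp₁ z) (hp₂ z) (hp₁ v) (hp₂ v)
    rw [hp_apply u]
    simp only [map_add, map_smul, LinearMap.add_apply, LinearMap.smul_apply, e.1, e.2, smul_zero,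
      add_zero]
  · rw [hp_apply]
    have x₁ : g A' X = 0 := by
      simp [hA', hX₁, hX₂]
    have x₂ : g B' X = 0 := by
      simp [hB', hX₁, hX₂]
    rw [x₁, x₂, zero_smul, zero_smul, add_zero]

end IsOrbitData

end OrbitAlgebra

/-! ### Degenerate orbits -/

section NullOrbits

variable {g F₁ F₂ : Vec →ₗ[ℝ] Vec →ₗ[ℝ] ℝ} {h : Idx → Idx → ℝ}
  {R : Vec →ₗ[ℝ] Vec →ₗ[ℝ] Vec →ₗ[ℝ] Vec →ₗ[ℝ] ℝ} {ξ η k : Vec}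

/-- A non-null vector and a null vector orthogonal to it are part of a null frame. -/
lemma exists_isNullFrame (hh : IsCometric g h) (hξ : g ξ ξ ≠ 0) (hξk : g ξ k = 0)
    (hkk : g k k = 0) (hk : k ≠ 0) : ∃ f l : Vec, IsNullFrame g ξ k f l := by
  obtain ⟨w, hw⟩ : ∃ w, g k w ≠ 0 := by
    by_contra! hc
    exact hk (hh.eq_zero hc)
  have hkξ : g k ξ = 0 := by rw [hh.1, hξk]
  obtain ⟨l, hkl, hξl, hll⟩ : ∃ l, g k l = 1 ∧ g ξ l = 0 ∧ g l l = 0 := by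
    let l₁ : Vec := (g k w)⁻¹ • w - ((g k w)⁻¹ * g ξ w / g ξ ξ) • ξ
    have h1 : g k l₁ = 1 := by
      simp only [l₁, map_sub, map_smul, hkξ, smul_eq_mul, mul_zero, sub_zero]
      exact inv_mul_cancel₀ hw
    have h2 : g ξ l₁ = 0 := by
      simp only [l₁, map_sub, map_smul, smul_eq_mul]
      field_simp
      ring
    refine ⟨l₁ - (g l₁ l₁ / 2) • k, ?_, ?_, ?_⟩
    · simp [h1, hkk]
    · simp [h2, hξk]
    · simp only [map_sub, map_smul, LinearMap.sub_apply, LinearMap.smul_apply, smul_eq_mul, h1,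
        hkk, hh.1 l₁ k]
      ring
  have hlk : g l k = 1 := by rw [hh.1, hkl]
  have hlξ : g l ξ = 0 := by rw [hh.1, hξl]
  -- The orthogonal complement of `ξ, k, l` is not zero, as these three vectors do not span.
  obtain ⟨f, hf, hξf, hkf, hlf⟩ : ∃ f, f ≠ 0 ∧ g ξ f = 0 ∧ g k f = 0 ∧ g l f = 0 := by
    let q (v : Vec) : Vec := v - ((g ξ v / g ξ ξ) • ξ + g l v • k + g k v • l)
    by_contra! hc
    have hq (v : Vec) : q v = 0 := by
      by_contra hv
      refine hc (q v) hv ?_ ?_ ?_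
      · simp only [q, map_sub, map_add, map_smul, smul_eq_mul, hξk, hξl]
        field_simp
        ring
      · simp only [q, map_sub, map_add, map_smul, smul_eq_mul, hkξ, hkk, hkl]
        ring
      · simp only [q, map_sub, map_add, map_smul, smul_eq_mul, hlξ, hlk, hll]
        ring
    have hspan : Submodule.span ℝ (Set.range ![ξ, k, l]) = ⊤ := by
      refine eq_top_iff.2 fun v _ ↦ ?_
      rw [sub_eq_zero.1 (hq v)]
      have m (i : Fin 3) := Submodule.subset_span (R := ℝ) (Set.mem_range_self (f := ![ξ, k, l]) i)
      exact add_mem (add_mem (Submodule.smul_mem _ _ (m 0)) (Submodule.smul_mem _ _ (m 1)))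
        (Submodule.smul_mem _ _ (m 2))
    have hle := finrank_range_le_card (R := ℝ) ![ξ, k, l]
    rw [Set.finrank, hspan, finrank_top] at hle
    simp at hle
  have hfξ : g f ξ = 0 := by rw [hh.1, hξf]
  have hfk : g f k = 0 := by rw [hh.1, hkf]
  have hfl : g f l = 0 := by rw [hh.1, hlf]
  have hli : LinearIndependent ℝ ![ξ, k, f, l] := by
    rw [Fintype.linearIndependent_iff]
    intro c hc
    simp only [Fin.sum_univ_four, Matrix.cons_val] at hc
    have c0 : c 0 = 0 := by simpa [hξk, hξf, hξl, hξ] using congrArg (g ξ) hc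
    have c1 : c 1 = 0 := by simpa [hlk, hlf, hlξ, hll] using congrArg (g l) hc
    have c3 : c 3 = 0 := by simpa [hkk, hkf, hkξ, hkl] using congrArg (g k) hc
    have c2 : c 2 = 0 := by simpa [c0, c1, c3, hf] using hc
    intro i
    fin_cases i <;> assumption
  have hexp (v : Vec) : ∃ c : ℝ, v = (g v ξ / g ξ ξ) • ξ + c • f + g v l • k + g v k • l := by
    have hv : v ∈ Submodule.span ℝ (Set.range ![ξ, k, f, l]) := by
      rw [hli.span_eq_top_of_card_eq_finrank' (by simp)]
      trivial
    obtain ⟨c, hc⟩ := (Submodule.mem_span_range_iff_exists_fun ℝ).1 hv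
    simp only [Fin.sum_univ_four, Matrix.cons_val] at hc
    have c0 : g v ξ / g ξ ξ = c 0 := by
      rw [← hc]; simp [hkξ, hfξ, hlξ, hξ]
    have c1 : g v l = c 1 := by rw [← hc]; simp [hkl, hfl, hξl, hll]
    have c3 : g v k = c 3 := by rw [← hc]; simp [hkk, hfk, hξk, hlk]
    refine ⟨c 2, ?_⟩
    rw [c0, c1, c3]
    conv_lhs => rw [← hc]
    abel
  have hff : g f f ≠ 0 := by
    intro h0
    refine hf (hh.eq_zero fun v ↦ ?_)
    obtain ⟨c, hc⟩ := hexp v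
    rw [hc]
    simp [hfξ, hfk, hfl, h0]
  refine ⟨f, l, hξ, hξk, hξf, hξl, hkk, hkf, hkl, hff, hfl, hll, fun v ↦ ?_⟩
  obtain ⟨c, hc⟩ := hexp v
  have e : g v f = c * g f f := by
    conv_lhs => rw [hc]
    simp [hξf, hkf, hlf]
  rw [e, mul_div_assoc, div_self hff, mul_one]
  exact hc

/-- The restrictions on the curvature at a point where the orbit, spanned by `e` and the null vector
`k`, is degenerate. -/
structure IsNullOrbitCurvature (R : Vec →ₗ[ℝ] Vec →ₗ[ℝ] Vec →ₗ[ℝ] Vec →ₗ[ℝ] ℝ)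
    (e k f l : Vec) : Prop where
  ekek : R e k e k = 0
  ekef : R e k e f = 0
  ekkf : R e k k f = 0
  efkf : R e f k f = 0
  kfkf : R k f k f = 0
  ekkl : R e k k l = 0
  kfkl : R k f k l = 0
  /-- The Ricci component `R_{ef}` vanishes. -/
  ekfl : R e k f l = R e l k f

/-- The components with three vectors in the orbit or three vectors orthogonal to it vanish as for a
nondegenerate orbit, but here `k` is counted on both sides. The others follow from the
differentiated conditions with the frame vector `l` transversal to the orbit and to its orthogonal
complement. -/
lemma IsOrbitData.isNullOrbitCurvature {f l : Vec} (hh : IsCometric g h)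
    (hD : IsOrbitData g F₁ F₂ R ξ k) (hF : IsNullFrame g ξ k f l) :
    IsNullOrbitCurvature R ξ k f l := by
  have hkξ : g k ξ = 0 := by rw [hh.1, hF.ek]
  have hlk : g l k = 1 := by rw [hh.1, hF.kl]
  have hlξ : g l ξ = 0 := by rw [hh.1, hF.el]
  have t {X : Vec} (hX₁ : g ξ X = 0) (hX₂ : g k X = 0) : R ξ k ξ X = 0 ∧ R ξ k k X = 0 :=
    ⟨by simpa using hD.curv_tangent 1 0 hX₁ hX₂ hh.1,
      by simpa using hD.curv_tangent 0 1 hX₁ hX₂ hh.1⟩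
  -- The vectors `ξ / g(ξ, ξ)` and `l` are dual to the covectors `ξ` and `k`.
  have hA₁ : g ξ ((g ξ ξ)⁻¹ • ξ) = 1 := by
    rw [map_smul, smul_eq_mul, inv_mul_cancel₀ hF.ee]
  have hA₂ : g k ((g ξ ξ)⁻¹ • ξ) = 0 := by rw [map_smul, hkξ, smul_zero]
  have n {X Y Z : Vec} := hD.curv_normal (X := X) (Y := Y) (Z := Z) hA₁ hA₂ hF.el hF.kl
  have f₁ξk := hD.F₁_ξ_η
  have f₂ξk := hD.F₂_ξ_η
  have f₁fk : F₁ f k = 0 := hD.orth₁ hF.ef hF.kf hF.ek hF.kk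
  have f₂fk : F₂ f k = 0 := hD.orth₂ hF.ef hF.kf hF.ek hF.kk
  have f₁kf : F₁ k f = 0 := hD.orth₁ hF.ek hF.kk hF.ef hF.kf
  have f₂kf : F₂ k f = 0 := hD.orth₂ hF.ek hF.kk hF.ef hF.kf
  have f₁ff : F₁ f f = 0 := by linarith [hD.anti₁ f f]
  have f₂ff : F₂ f f = 0 := by linarith [hD.anti₂ f f]
  have f₁kk : F₁ k k = 0 := by linarith [hD.anti₁ k k]
  have f₂kk : F₂ k k = 0 := by linarith [hD.anti₂ k k]
  have f₂fξ : F₂ f ξ = 0 := by rw [hD.comm, f₁fk]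
  have f₂ξf : F₂ ξ f = 0 := by rw [hD.anti₂, f₂fξ, neg_zero]
  have expand {a : Vec} {F : Vec →ₗ[ℝ] Vec →ₗ[ℝ] ℝ} {W : Vec} (ha : ∀ Z, g a Z = F Z W) :
      a = (F ξ W / g ξ ξ) • ξ + (F f W / g f f) • f + F l W • k + F k W • l := by
    have := hF.expand a
    simpa only [ha] using this
  have c₁ := hD.curv_orth₁ l hA₁ hA₂ hF.el hF.kl hF.ef hF.kf hF.ek hF.kk
  have c₂ := hD.curv_orth₂ l hA₁ hA₂ hF.el hF.kl hF.ef hF.kf hF.ek hF.kk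
  simp only [map_smul, LinearMap.smul_apply, smul_eq_mul, f₁ξk, f₂ξk, f₂ξf] at c₁ c₂
  refine ⟨(t hF.ek hF.kk).1, (t hF.ef hF.kf).1, (t hF.ef hF.kf).2, ?_, ?_, ?_, ?_, ?_⟩
  · exact (n hF.ek hF.kk hF.ef hF.kf hF.ef hF.kf).1
  · exact (n hF.ek hF.kk hF.ef hF.kf hF.ef hF.kf).2
  · obtain ⟨a, b, ha, hb, hab⟩ := hD.curv_comm k
    rw [hab, expand ha, expand hb]
    simp only [map_add, map_smul, smul_eq_mul, f₁ξk, f₂ξk, f₁fk, f₂fk, f₁kk, f₂kk]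
    ring
  · rw [hD.curv.pair, hD.curv.swap_right, c₂, hD.anti₂ f l, hD.anti₂ k l]
    ring
  · obtain ⟨a, b, ha, hb, hab⟩ := hD.curv_comm f
    rw [hab, expand ha, expand hb, hD.curv.swap_right ξ l k f, c₁]
    simp only [map_add, map_smul, smul_eq_mul, f₁ff, f₂ff, f₁kf, f₂kf, f₂ξf, hD.comm]
    rw [hD.anti₂ f l, hD.anti₂ k l, hD.anti₁ f l, hD.anti₁ k l]
    ring

/-- The contraction of bilinear forms in a null frame. -/
lemma contrTwo_nullFrame {e f l : Vec} (hh : IsCometric g h) (hF : IsNullFrame g e k f l)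
    (M L : Vec →ₗ[ℝ] Vec →ₗ[ℝ] ℝ) :
    contrTwo h M L =
      (M e e * L e e / g e e + M e f * L e f / g f f + M e k * L e l + M e l * L e k) / g e e
      + (M f e * L f e / g e e + M f f * L f f / g f f + M f k * L f l + M f l * L f k) / g f f
      + (M k e * L l e / g e e + M k f * L l f / g f f + M k k * L l l + M k l * L l k)
      + (M l e * L k e / g e e + M l f * L k f / g f f + M l k * L k l + M l l * L k k) := by
  simp only [contrTwo, contrOne, contrLift_nullFrame hh hF, LinearMap.mul_apply']

set_option maxHeartbeats 2000000 in
/-- In a null frame, the Bel tensor vanishes on three vectors of the orbit and one orthogonal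
vector. The terms with a factor `g` vanish separately, and the first two terms cancel, since
`R_{ekfl} = R_{elkf}`. -/
lemma belForm_nullFrame {e f l : Vec} (hh : IsCometric g h) (hR : IsCurvatureForm R)
    (hF : IsNullFrame g e k f l) (hN : IsNullOrbitCurvature R e k f l) {A B C X : Vec}
    (hA : A = e ∨ A = k) (hB : B = e ∨ B = k) (hC : C = e ∨ C = k) (hX : X = f ∨ X = k) :
    belForm g h R A B C X = 0 := by
  have hCX : g C X = 0 := by
    rcases hC with rfl | rfl <;> rcases hX with rfl | rfl
    exacts [hF.ef, hF.ek, hF.kf, hF.kk]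
  have hcyc : R e f k l = R e k f l + R e l k f := by
    have := hR.cyclic e k f l
    rw [hR.swap_right e f l k] at this
    linarith
  -- Normal forms of the curvature components with respect to the pair symmetries.
  have s₁ (x y : Vec) := hR.swap_left k e x y
  have s₂ (x y : Vec) := hR.swap_left f e x y
  have s₃ (x y : Vec) := hR.swap_left l e x y
  have s₄ (x y : Vec) := hR.swap_left f k x y
  have s₅ (x y : Vec) := hR.swap_left l k x y
  have s₆ (x y : Vec) := hR.swap_left l f x y
  have r₁ (x y : Vec) := hR.swap_right x y k e
  have r₂ (x y : Vec) := hR.swap_right x y f e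
  have r₃ (x y : Vec) := hR.swap_right x y l e
  have r₄ (x y : Vec) := hR.swap_right x y f k
  have r₅ (x y : Vec) := hR.swap_right x y l k
  have r₆ (x y : Vec) := hR.swap_right x y l f
  have p₁ := hR.pair e f e k
  have p₂ := hR.pair e l e k
  have p₃ := hR.pair k f e k
  have p₄ := hR.pair k l e k
  have p₅ := hR.pair f l e k
  have p₆ := hR.pair e l e f
  have p₇ := hR.pair k f e f
  have p₈ := hR.pair k l e f
  have p₉ := hR.pair f l e f
  have q₁ := hR.pair k f e l
  have q₂ := hR.pair k l e l
  have q₃ := hR.pair f l e l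
  have q₄ := hR.pair k l k f
  have q₅ := hR.pair f l k f
  have q₆ := hR.pair f l k l
  have hthree : contrThree h (slotThree R C) (slotThree R X) = 0 := by
    rw [contrThree, contrLift_nullFrame hh hF]
    simp only [contrTwo_nullFrame hh hF]
    rcases hC.imp Eq.symm Eq.symm with rfl | rfl <;>
      rcases hX.imp Eq.symm Eq.symm with rfl | rfl <;>
      simp only [slotThree_apply, s₁, s₂, s₃, s₄, s₅, s₆, r₁, r₂, r₄, p₁, p₂, p₃, p₄, p₅, p₆,
        p₇, p₈, p₉, q₁, q₂, q₃, q₄, q₅, q₆, hR.self_left, hR.self_right, hN.ekek,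
        hN.ekef, hN.ekkf, hN.efkf, hN.kfkf, hN.ekkl, hN.kfkl, hN.ekfl, hcyc, mul_zero,
        zero_mul, neg_zero, zero_div, add_zero, zero_add]
    all_goals ring
  have htwo : contrTwo h ((R A).flip C) ((R B).flip X) + contrTwo h ((R A).flip X) ((R B).flip C)
      = 0 := by
    rw [contrTwo_nullFrame hh hF ((R A).flip C), contrTwo_nullFrame hh hF ((R A).flip X)]
    rcases hA.imp Eq.symm Eq.symm with rfl | rfl <;>
      rcases hB.imp Eq.symm Eq.symm with rfl | rfl <;>
      rcases hC.imp Eq.symm Eq.symm with rfl | rfl <;>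
      rcases hX.imp Eq.symm Eq.symm with rfl | rfl <;>
      simp only [LinearMap.flip_apply, s₁, r₁, r₂, r₄, p₁, p₂, p₃, p₄, p₆, p₇, p₈, q₁, q₂, q₄,
        hR.self_left, hR.self_right, hN.ekek, hN.ekef, hN.ekkf, hN.efkf, hN.kfkf,
        hN.ekkl, hN.kfkl, hN.ekfl, hcyc, mul_zero, zero_mul, neg_zero, zero_div,
        add_zero, zero_add]
    all_goals ring
  rw [belForm, htwo, hthree, hCX]
  ring

end NullOrbits

/-! ### Linearity and symmetrization of the Bel tensor -/

section Multilinearity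

variable (g : Vec →ₗ[ℝ] Vec →ₗ[ℝ] ℝ) (h : Idx → Idx → ℝ)
  (R : Vec →ₗ[ℝ] Vec →ₗ[ℝ] Vec →ₗ[ℝ] Vec →ₗ[ℝ] ℝ) (c d : ℝ) (v z A B C X : Vec)

lemma flip_comb (M L : Vec →ₗ[ℝ] Vec →ₗ[ℝ] Vec →ₗ[ℝ] ℝ) :
    (c • M + d • L).flip C = c • M.flip C + d • L.flip C := rfl

lemma belForm_comb₁ : belForm g h R (c • v + d • z) B C X
    = c * belForm g h R v B C X + d * belForm g h R z B C X := by
  simp only [belForm, flip_comb, map_add, map_smul, LinearMap.add_apply, LinearMap.smul_apply,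
    smul_eq_mul]
  ring

lemma belForm_comb₂ : belForm g h R A (c • v + d • z) C X
    = c * belForm g h R A v C X + d * belForm g h R A z C X := by
  simp only [belForm, flip_comb, map_add, map_smul, smul_eq_mul]
  ring

lemma belForm_comb₃ : belForm g h R A B (c • v + d • z) X
    = c * belForm g h R A B v X + d * belForm g h R A B z X := by
  simp only [belForm, map_add, map_smul, LinearMap.add_apply, LinearMap.smul_apply, smul_eq_mul]
  ring

lemma belForm_comb₄ : belForm g h R A B C (c • v + d • z)
    = c * belForm g h R A B C v + d * belForm g h R A B C z := by
  simp only [belForm, map_add, map_smul, LinearMap.add_apply, LinearMap.smul_apply, smul_eq_mul]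
  ring

lemma sum_comb {φ : Vec → ℝ} (hφ : ∀ (c d : ℝ) v z, φ (c • v + d • z) = c * φ v + d * φ z)
    (v : Vec) : ∑ i, φ (Pi.single i 1) * v i = φ v :=
  sum_linear (fun v z ↦ by simpa using hφ 1 1 v z) (fun c v ↦ by simpa using hφ c 0 v 0) v

/-- The Bel tensor symmetrized in its first three arguments. -/
def symBelForm : ℝ := (1 / 6) * (belForm g h R A B C X + belForm g h R A C B X
  + belForm g h R B A C X + belForm g h R B C A X + belForm g h R C A B X + belForm g h R C B A X)

lemma sum_symBelForm :
    ∑ μ, (∑ α, ∑ β, ∑ l, symBelForm g h R (Pi.single α 1) (Pi.single β 1) (Pi.single l 1)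
      (Pi.single μ 1) * A α * B β * C l) * X μ = symBelForm g h R A B C X := by
  have h1 (B C X) := sum_comb (φ := fun A ↦ symBelForm g h R A B C X) (fun c d v z ↦ by
    simp only [symBelForm, belForm_comb₁, belForm_comb₂, belForm_comb₃]; ring) A
  have h2 (A C X) := sum_comb (φ := fun B ↦ symBelForm g h R A B C X) (fun c d v z ↦ by
    simp only [symBelForm, belForm_comb₁, belForm_comb₂, belForm_comb₃]; ring) B
  have h3 (A B X) := sum_comb (φ := fun C ↦ symBelForm g h R A B C X) (fun c d v z ↦ by
    simp only [symBelForm, belForm_comb₁, belForm_comb₂, belForm_comb₃]; ring) C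
  have h4 (A B C) := sum_comb (φ := fun X ↦ symBelForm g h R A B C X) (fun c d v z ↦ by
    simp only [symBelForm, belForm_comb₄]; ring) X
  rw [← h4]
  refine Finset.sum_congr rfl fun μ _ ↦ congrArg (· * X μ) ?_
  rw [← h1]
  refine Finset.sum_congr rfl fun α _ ↦ ?_
  rw [← h2, Finset.sum_mul]
  refine Finset.sum_congr rfl fun β _ ↦ ?_
  rw [← h3, Finset.sum_mul, Finset.sum_mul]
  exact Finset.sum_congr rfl fun l _ ↦ by ring

lemma symz_three_eq (T : (Fin 3 → Idx) → ℝ) (a : Fin 3 → Idx) :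
    symz T a = (1 / 6) * (T ![a 0, a 1, a 2] + T ![a 0, a 2, a 1] + T ![a 1, a 0, a 2]
      + T ![a 1, a 2, a 0] + T ![a 2, a 0, a 1] + T ![a 2, a 1, a 0]) := by
  have h : (Finset.univ : Finset (Equiv.Perm (Fin 3))) = {1, Equiv.swap 0 1, Equiv.swap 0 2,
      Equiv.swap 1 2, Equiv.swap 0 1 * Equiv.swap 1 2, Equiv.swap 1 2 * Equiv.swap 0 1} := by
    decide
  have e (s : Equiv.Perm (Fin 3)) : a ∘ s = ![a (s 0), a (s 1), a (s 2)] := by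
    ext i; fin_cases i <;> rfl
  simp only [symz, e]
  rw [h, Finset.sum_insert (by decide), Finset.sum_insert (by decide),
    Finset.sum_insert (by decide), Finset.sum_insert (by decide), Finset.sum_insert (by decide),
    Finset.sum_singleton]
  simp [Equiv.swap_apply_def, Nat.factorial]
  ring

end Multilinearity

/-! ### Orbits of any causal character -/

section Orbits

variable {g F₁ F₂ : Vec →ₗ[ℝ] Vec →ₗ[ℝ] ℝ} {h : Idx → Idx → ℝ}
  {R : Vec →ₗ[ℝ] Vec →ₗ[ℝ] Vec →ₗ[ℝ] Vec →ₗ[ℝ] ℝ} {ξ η : Vec}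

/-- The Bel tensor vanishes on three vectors of the orbit and one orthogonal vector, whatever the
causal character of the orbit. -/
lemma IsOrbitData.belForm_eq_zero (hh : IsCometric g h) (hD : IsOrbitData g F₁ F₂ R ξ η)
    (hξ : g ξ ξ ≠ 0) (hli : ∀ t : ℝ, η ≠ t • ξ) {A B C X : Vec}
    (hA : ∃ a b : ℝ, A = a • ξ + b • η) (hB : ∃ a b : ℝ, B = a • ξ + b • η)
    (hC : ∃ a b : ℝ, C = a • ξ + b • η) (hX₁ : g ξ X = 0) (hX₂ : g η X = 0) :
    belForm g h R A B C X = 0 := by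
  by_cases hdet : g ξ ξ * g η η - g ξ η ^ 2 = 0
  swap
  · exact hD.belForm_eq_zero_of_nondegenerate hh hdet hA hB hC hX₁ hX₂
  -- The null direction of the orbit.
  obtain ⟨t, k, hk, hξk, hkk⟩ : ∃ (t : ℝ) (k : Vec), k = η - t • ξ ∧ g ξ k = 0 ∧ g k k = 0 := by
    refine ⟨g ξ η / g ξ ξ, _, rfl, ?_, ?_⟩
    · simp only [map_sub, map_smul, smul_eq_mul]
      field_simp
      ring
    · simp only [map_sub, map_smul, LinearMap.sub_apply, LinearMap.smul_apply, smul_eq_mul,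
        hh.1 η ξ]
      field_simp
      linear_combination hdet
  have hη : η = t • ξ + k := by rw [hk]; abel
  have hD' := hD.sub_smul t
  rw [← hk] at hD'
  obtain ⟨f, l, hF⟩ := exists_isNullFrame hh hξ hξk hkk fun h0 ↦ hli t (by rw [hη, h0, add_zero])
  have hN := hD'.isNullOrbitCurvature hh hF
  have hX₃ : g k X = 0 := by rw [hk]; simp [hX₁, hX₂]
  have comb {A : Vec} : (∃ a b : ℝ, A = a • ξ + b • η) → ∃ a b : ℝ, A = a • ξ + b • k := by
    rintro ⟨a, b, rfl⟩
    exact ⟨a + b * t, b, by rw [hη]; module⟩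
  obtain ⟨a₁, a₂, rfl⟩ := comb hA
  obtain ⟨b₁, b₂, rfl⟩ := comb hB
  obtain ⟨c₁, c₂, rfl⟩ := comb hC
  have hX : X = (g X f / g f f) • f + g X l • k := by
    conv_lhs => rw [hF.expand X, hh.1 X ξ, hh.1 X k, hX₁, hX₃]
    simp
  rw [hX]
  have key {A B C X : Vec} (hA : A = ξ ∨ A = k) (hB : B = ξ ∨ B = k) (hC : C = ξ ∨ C = k)
      (hX : X = f ∨ X = k) := belForm_nullFrame hh hD'.curv hF hN hA hB hC hX
  have l₁ {x : Vec} : x = x ∨ x = k := Or.inl rfl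
  have l₂ {x : Vec} : k = x ∨ k = k := Or.inr rfl
  simp only [belForm_comb₁, belForm_comb₂, belForm_comb₃, belForm_comb₄, key l₁ l₁ l₁ l₁,
    key l₁ l₁ l₁ l₂, key l₁ l₁ l₂ l₁, key l₁ l₁ l₂ l₂, key l₁ l₂ l₁ l₁, key l₁ l₂ l₁ l₂,
    key l₁ l₂ l₂ l₁, key l₁ l₂ l₂ l₂, key l₂ l₁ l₁ l₁, key l₂ l₁ l₁ l₂, key l₂ l₁ l₂ l₁,
    key l₂ l₁ l₂ l₂, key l₂ l₂ l₁ l₁, key l₂ l₂ l₁ l₂, key l₂ l₂ l₂ l₁, key l₂ l₂ l₂ l₂,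
    mul_zero, add_zero]

/-- Vectors dual to the covectors `ξ` and `η`. -/
lemma exists_dual_pair (hh : IsCometric g h) (hξ : g ξ ξ ≠ 0) (hli : ∀ t : ℝ, η ≠ t • ξ) :
    ∃ A B : Vec, g ξ A = 1 ∧ g η A = 0 ∧ g ξ B = 0 ∧ g η B = 1 := by
  obtain ⟨w, hw⟩ : ∃ w, g (η - (g ξ η / g ξ ξ) • ξ) w ≠ 0 := by
    by_contra! hc
    exact hli _ (sub_eq_zero.1 (hh.eq_zero hc))
  simp only [map_sub, map_smul, LinearMap.sub_apply, LinearMap.smul_apply, smul_eq_mul] at hw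
  set m := g η w - g ξ η / g ξ ξ * g ξ w with hm
  obtain ⟨B, hB₁, hB₂⟩ : ∃ B, g ξ B = 0 ∧ g η B = 1 := by
    refine ⟨m⁻¹ • (w - (g ξ w / g ξ ξ) • ξ), ?_, ?_⟩
    · simp only [map_sub, map_smul, smul_eq_mul]
      rw [div_mul_cancel₀ _ hξ, sub_self, mul_zero]
    · simp only [map_sub, map_smul, smul_eq_mul, hh.1 η ξ]
      rw [div_mul_eq_mul_div, mul_comm (g ξ w), ← div_mul_eq_mul_div, ← hm]
      exact inv_mul_cancel₀ hw
  refine ⟨(g ξ ξ)⁻¹ • (ξ - g η ξ • B), B, ?_, ?_, hB₁, hB₂⟩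
  · simp [hB₁, hξ]
  · simp [hB₂]

end Orbits

/-! ### The pointwise data of Killing fields -/

section PointwiseData

variable {U : Set E4} {y : E4} {G : Idx → Idx → E4 → ℝ} {u w u₁ w₁ u₂ w₂ : Idx → E4 → ℝ}

lemma IsMetricOn.isCometric (hG : IsMetricOn U G) (hy : y ∈ U) :
    IsCometric (metricForm G y) (fun i j ↦ metricInv G i j y) := by
  refine ⟨fun v w ↦ ?_, fun ρ v ↦ ?_⟩
  · simp only [bilForm_apply]
    rw [Finset.sum_comm]
    exact Finset.sum_congr rfl fun i _ ↦ Finset.sum_congr rfl fun j _ ↦ by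
      rw [hG.symm j i]; ring
  · simp only [bilForm_apply]
    rw [Finset.sum_comm]
    have (j : Idx) : ∑ i, G i j y * (metricInv G ρ i y * v j) = (if j = ρ then 1 else 0) * v j := by
      rw [← hG.sum_mul_metricInv hy, Finset.sum_mul]
      exact Finset.sum_congr rfl fun i _ ↦ by rw [hG.symm i j, hG.metricInv_symm ρ i]; ring
    simp [this]

lemma IsMetricOn.isCurvatureForm (hG : IsMetricOn U G) (hy : y ∈ U) :
    IsCurvatureForm (riemannForm G y) := by
  have hl (u v w z : Vec) : riemannForm G y u v w z = -riemannForm G y v u w z := by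
    simp only [quadForm_apply, ← Finset.sum_neg_distrib]
    rw [Finset.sum_comm]
    exact Finset.sum_congr rfl fun i _ ↦ Finset.sum_congr rfl fun j _ ↦
      Finset.sum_congr rfl fun k _ ↦ Finset.sum_congr rfl fun l _ ↦ by
        rw [hG.riemann_swap_left hy]; ring
  have hr (u v w z : Vec) : riemannForm G y u v w z = -riemannForm G y u v z w := by
    simp only [quadForm_apply, ← Finset.sum_neg_distrib]
    refine Finset.sum_congr rfl fun i _ ↦ Finset.sum_congr rfl fun j _ ↦ ?_
    rw [Finset.sum_comm]
    exact Finset.sum_congr rfl fun k _ ↦ Finset.sum_congr rfl fun l _ ↦ by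
      rw [riemann_swap_right]; ring
  have hc (u v w z : Vec) : riemannForm G y u v w z + riemannForm G y u w z v
      + riemannForm G y u z v w = 0 := by
    refine eq_zero_of_linear (φ := fun u ↦ riemannForm G y u v w z + riemannForm G y u w z v
      + riemannForm G y u z v w) (fun _ _ ↦ by simp; ring) (fun _ _ ↦ by simp; ring) (fun i ↦ ?_) u
    refine eq_zero_of_linear (φ := fun v ↦ riemannForm G y (Pi.single i 1) v w z
      + riemannForm G y (Pi.single i 1) w z v + riemannForm G y (Pi.single i 1) z v w)
      (fun _ _ ↦ by simp; ring) (fun _ _ ↦ by simp; ring) (fun j ↦ ?_) v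
    refine eq_zero_of_linear (φ := fun w ↦ riemannForm G y (Pi.single i 1) (Pi.single j 1) w z
      + riemannForm G y (Pi.single i 1) w z (Pi.single j 1)
      + riemannForm G y (Pi.single i 1) z (Pi.single j 1) w)
      (fun _ _ ↦ by simp; ring) (fun _ _ ↦ by simp; ring) (fun k ↦ ?_) w
    refine eq_zero_of_linear (φ := fun z ↦
      riemannForm G y (Pi.single i 1) (Pi.single j 1) (Pi.single k 1) z
      + riemannForm G y (Pi.single i 1) (Pi.single k 1) z (Pi.single j 1)
      + riemannForm G y (Pi.single i 1) z (Pi.single j 1) (Pi.single k 1))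
      (fun _ _ ↦ by simp; ring) (fun _ _ ↦ by simp; ring) (fun l ↦ ?_) z
    simp only [quadForm_single]
    exact hG.riemann_cyclic i j k l y
  refine ⟨hl, hr, fun u v w z ↦ ?_, hc⟩
  linarith [hc u v w z, hc v w z u, hc w z u v, hc z u v w, hl u w z v, hl u z v w, hl v w z u,
    hr v w z u, hl v z u w, hr v z u w, hl w u v z, hr w u v z, hr w z u v, hl w v z u,
    hr u w z v, hr u z v w, hr z u v w, hl z v w u, hr z v w u, hl u v w z, hr u v w z,
    hl z w u v, hr z w u v, hl w z u v, hr w v z u]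

lemma IsKillingOn.anti (hK : IsKillingOn U G u w) (hy : y ∈ U) (v z : Vec) :
    covDerivForm G w y v z = -covDerivForm G w y z v :=
  bilForm_antisymm (hK.killing y hy) v z

lemma wedgeForm_swap {E : Type*} (α β : E → ℝ) (F : E → E → ℝ) (A B C D : E) :
    wedgeForm α β F A B C D = -wedgeForm β α F A B C D := by
  unfold wedgeForm; ring

/-- The pointwise data of two commuting Killing fields whose group acts orthogonally
transitively. -/
lemma IsMetricOn.isOrbitData (hG : IsMetricOn U G) (hK₁ : IsKillingOn U G u₁ w₁)
    (hK₂ : IsKillingOn U G u₂ w₂) (hy : y ∈ U)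
    (hc : ∀ z ∈ U, ∀ i, ∑ j, (u₁ j z * pd j (u₂ i) z - u₂ j z * pd j (u₁ i) z) = 0)
    (h₁ : ∀ z ∈ U, ∀ A B C D : Vec, wedgeForm (lowerForm w₁ z) (lowerForm w₂ z)
      (fun X Y ↦ covDerivForm G w₁ z X Y) A B C D = 0)
    (h₂ : ∀ z ∈ U, ∀ A B C D : Vec, wedgeForm (lowerForm w₁ z) (lowerForm w₂ z)
      (fun X Y ↦ covDerivForm G w₂ z X Y) A B C D = 0)
    (hξ : metricForm G y (fun i ↦ u₁ i y) (fun i ↦ u₁ i y) ≠ 0)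
    (hli : ∀ t : ℝ, (fun i ↦ u₂ i y) ≠ t • (fun i ↦ u₁ i y)) :
    IsOrbitData (metricForm G y) (covDerivForm G w₁ y) (covDerivForm G w₂ y) (riemannForm G y)
      (fun i ↦ u₁ i y) (fun i ↦ u₂ i y) := by
  have hR := hG.isCurvatureForm hy
  have e₁ := linForm_eq_bilForm hG hK₁ hy
  have e₂ := linForm_eq_bilForm hG hK₂ hy
  obtain ⟨A, B, hA₁, hA₂, hB₁, hB₂⟩ := exists_dual_pair (hG.isCometric hy) hξ hli
  rw [← e₁] at hA₁ hB₁
  rw [← e₂] at hA₂ hB₂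
  refine ⟨hR, hK₁.anti hy, hK₂.anti hy, bilForm_covDeriv_comm hG hK₁ hK₂ hy (hc y hy),
    fun W ↦ ?_, ?_, ?_, ?_, ?_⟩
  · obtain ⟨a, b, ha, hb, hab⟩ := quadForm_of_comm hG hK₁ hK₂ hy hc W
    refine ⟨a, b, ha, hb, fun Z ↦ ?_⟩
    have h1 := hab Z
    have h2 := hR.cyclic (fun i ↦ u₁ i y) (fun i ↦ u₂ i y) W Z
    have h3 := hR.pair (fun i ↦ u₂ i y) W Z (fun i ↦ u₁ i y)
    have h4 := hR.swap_left Z (fun i ↦ u₁ i y) (fun i ↦ u₂ i y) W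
    linarith
  · intro X Y hX₁ hX₂ hY₁ hY₂
    rw [← e₁] at hX₁ hY₁
    rw [← e₂] at hX₂ hY₂
    have := h₁ y hy A B X Y
    simp only [wedgeForm, hA₁, hA₂, hB₁, hB₂, hX₁, hX₂, hY₁, hY₂] at this
    linarith
  · intro X Y hX₁ hX₂ hY₁ hY₂
    rw [← e₁] at hX₁ hY₁
    rw [← e₂] at hX₂ hY₂
    have := h₂ y hy A B X Y
    simp only [wedgeForm, hA₁, hA₂, hB₁, hB₂, hX₁, hX₂, hY₁, hY₂] at this
    linarith
  · intro A B X Y W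
    simp only [← e₁, ← e₂]
    exact deriv_wedgeForm hG hK₁ hK₂ hK₁ hy h₁ W
  · intro A B X Y W
    simp only [← e₁, ← e₂]
    exact deriv_wedgeForm hG hK₁ hK₂ hK₂ hy h₂ W

end PointwiseData

/-! ### Bel currents -/

section Currents

variable {V : Type*} [TopologicalSpace V] [ChartedSpace E4 V] [IsManifold (𝓡 4) ∞ V]
  {g : LorentzMetric V} {e : OpenPartialHomeomorph V E4} {y : E4} {v w ξ₁ ξ₂ ξ₃ : VField V}

/-- The contravariant components of a vector field at one point. -/
abbrev upperVec (v : VField V) (e : OpenPartialHomeomorph V E4) (y : E4) : Vec :=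
  fun i ↦ upperComp v e i y

lemma isMetricOn_metricComp (he : e ∈ IsManifold.maximalAtlas (𝓡 4) ∞ V) (g : LorentzMetric V) :
    IsMetricOn e.target (metricComp g e) where
  isOpen := e.open_target
  smooth := contDiffOn_metricComp he g
  symm i j := funext fun y ↦ metricComp_symm g e i j y
  det_ne_zero _ hy := det_metricComp_ne_zero he hy g

lemma IsKilling.isKillingOn (hv : IsKilling g v) (he : e ∈ IsManifold.maximalAtlas (𝓡 4) ∞ V) :
    IsKillingOn e.target (metricComp g e) (upperComp v e) (lowerComp g v e) where
  smooth_upper := contDiffOn_upperComp he hv.1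
  smooth_lower i := (ContDiffOn.sum fun j _ ↦ (contDiffOn_metricComp he g i j).mul
    (contDiffOn_upperComp he hv.1 j)).congr fun z hz ↦ lowerComp_eq_sum he hz g v i
  lower z hz := lowerComp_eq_sum he hz g v
  killing z hz i j := by
    have h := hv.2 e he z hz ![i, j]
    have hu : (Finset.univ : Finset (Equiv.Perm (Fin 2))) = {1, Equiv.swap 0 1} := by decide
    rw [symz, hu, Finset.sum_insert (by decide), Finset.sum_singleton] at h
    simp only [Function.comp, Equiv.Perm.coe_one, id, Equiv.swap_apply_left,
      Equiv.swap_apply_right, Matrix.cons_val] at h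
    have h' := (mul_eq_zero.1 h).resolve_left (by positivity)
    simp only [nabla] at h'
    linarith

/-- The contraction of the Bel current with a vector. -/
lemma sum_belCurrent (g : LorentzMetric V) (ξ₁ ξ₂ ξ₃ : VField V) (e : OpenPartialHomeomorph V E4)
    (y : E4) (X : Vec) :
    ∑ μ, belCurrent g ξ₁ ξ₂ ξ₃ e μ y * X μ
      = symBelForm (metricForm (metricComp g e) y) (fun i j ↦ metricInv (metricComp g e) i j y)
        (riemannForm (metricComp g e) y) (upperVec ξ₁ e y) (upperVec ξ₂ e y) (upperVec ξ₃ e y)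
        X := by
  rw [← sum_symBelForm]
  refine Finset.sum_congr rfl fun μ _ ↦ congrArg (· * X μ) ?_
  refine Finset.sum_congr rfl fun α _ ↦ Finset.sum_congr rfl fun β _ ↦
    Finset.sum_congr rfl fun l _ ↦ ?_
  rw [symz_three_eq]
  simp only [bel, belOf_eq_belForm, symBelForm, Matrix.cons_val]

/-- `g(v, v)` in components. -/
lemma val_self_eq (he : e ∈ IsManifold.maximalAtlas (𝓡 4) ∞ V) (hy : y ∈ e.target)
    (g : LorentzMetric V) (v : VField V) :
    g.val (e.symm y) (v (e.symm y)) (v (e.symm y))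
      = metricForm (metricComp g e) y (upperVec v e y) (upperVec v e y) := by
  refine (congrArg (g.val (e.symm y) (v (e.symm y)))
    (eq_sum_upperComp_smul_coordVec he hy v)).trans ?_
  rw [map_sum, bilForm_apply]
  refine Finset.sum_congr rfl fun i _ ↦ ?_
  have h := lowerComp_eq_sum he hy g v i
  rw [lowerComp] at h
  rw [map_smul, h, smul_eq_mul, Finset.mul_sum]
  exact Finset.sum_congr rfl fun j _ ↦ by ring

/-- A linear relation between two vectors holds for their covariant components. -/
lemma lowerComp_comb (g : LorentzMetric V) {a b : ℝ}
    (h : a • v (e.symm y) + b • w (e.symm y) = 0) (i : Idx) :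
    a * lowerComp g v e i y + b * lowerComp g w e i y = 0 := by
  have := congrArg (fun x ↦ g.val (e.symm y) x (coordVec e y i)) h
  simpa [lowerComp] using this

/-- The Bel current of a non-null integrable Killing field is proportional to the field. -/
lemma exists_belCurrent_eq_mul (hξ : IsKilling g v) (hn : IsNonNull g v)
    (ho : IsHypersurfaceOrthogonal g v) (he : e ∈ IsManifold.maximalAtlas (𝓡 4) ∞ V)
    (hy : y ∈ e.target) :
    ∃ c : ℝ, ∀ μ, belCurrent g v v v e μ y = c * lowerComp g v e μ y := by
  have hG := isMetricOn_metricComp he g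
  have hK := hξ.isKillingOn he
  by_cases h0 : v (e.symm y) = 0
  · refine ⟨0, fun μ ↦ ?_⟩
    have (i : Idx) : upperComp v e i y = 0 := by
      simp [upperComp, h0]
      rfl
    simp [belCurrent, this]
  have hvv := hn _ h0
  rw [val_self_eq he hy] at hvv
  have hw (z : E4) (hz : z ∈ e.target) := linForm_bilForm_wedge
    (sum_eq_zero_of_antisymz_three (v := fun i ↦ lowerComp g v e i z)
      (F := fun i j ↦ covDeriv (metricComp g e) (lowerComp g v e) i j z) (hK.killing z hz)
      (ho e he z hz))
  have hd := deriv_hypersurfaceOrthogonal hG hK hy hw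
  have hw' := hw y hy
  have e₁ := linForm_eq_bilForm hG hK hy
  simp only [e₁] at hd hw'
  -- The current annihilates the orthogonal complement of the Killing vector.
  have key {X : Vec} (hX : metricForm (metricComp g e) y (upperVec v e y) X = 0) :
      ∑ μ, belCurrent g v v v e μ y * X μ = 0 := by
    rw [sum_belCurrent, symBelForm, belForm_eq_zero_of_hypersurfaceOrthogonal (hG.isCometric hy)
      (hG.isCurvatureForm hy) hvv hw' hd hX]
    ring
  set q := metricForm (metricComp g e) y (upperVec v e y) (upperVec v e y) with hq
  refine ⟨(∑ μ, belCurrent g v v v e μ y * upperComp v e μ y) / q, fun μ ↦ ?_⟩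
  have := key (X := Pi.single μ 1 - (lowerComp g v e μ y / q) • upperVec v e y) (by
    rw [map_sub, map_smul, ← e₁, linForm_single, smul_eq_mul, ← hq, div_mul_cancel₀ _ hvv,
      sub_self])
  simp only [Pi.sub_apply, Pi.smul_apply, smul_eq_mul, mul_sub, Finset.sum_sub_distrib] at this
  simp only [Pi.single_apply, mul_ite, mul_one, mul_zero, Finset.sum_ite_eq', Finset.mem_univ,
    if_true] at this
  rw [sub_eq_zero.1 this, Finset.sum_div, Finset.sum_mul]
  exact Finset.sum_congr rfl fun i _ ↦ by ring

/-- The Bel currents of an orthogonally transitive abelian group are tangent to the orbits, at the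
points where the two Killing vectors are independent. -/
lemma exists_belCurrent_eq_add (hv : IsKilling g v) (hw : IsKilling g w) (hn : IsNonNull g v)
    (hc : ∀ p : V, VectorField.mlieBracket (𝓡 4) v w p = 0) (ho : IsOrthogonallyTransitive g v w)
    (he : e ∈ IsManifold.maximalAtlas (𝓡 4) ∞ V) (hy : y ∈ e.target)
    (hli : LinearIndependent ℝ ![v (e.symm y), w (e.symm y)])
    (h₁ : ξ₁ = v ∨ ξ₁ = w) (h₂ : ξ₂ = v ∨ ξ₂ = w) (h₃ : ξ₃ = v ∨ ξ₃ = w) :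
    ∃ c d : ℝ, ∀ μ, belCurrent g ξ₁ ξ₂ ξ₃ e μ y
      = c * lowerComp g v e μ y + d * lowerComp g w e μ y := by
  have hG := isMetricOn_metricComp he g
  have hK₁ := hv.isKillingOn he
  have hK₂ := hw.isKillingOn he
  have hvv := hn _ (hli.ne_zero 0)
  rw [val_self_eq he hy] at hvv
  have hli' (t : ℝ) : upperVec w e y ≠ t • upperVec v e y := by
    intro ht
    have : w (e.symm y) = t • v (e.symm y) := by
      rw [eq_sum_upperComp_smul_coordVec he hy w, eq_sum_upperComp_smul_coordVec he hy v,
        Finset.smul_sum]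
      refine Finset.sum_congr rfl fun i _ ↦ ?_
      rw [smul_smul]
      exact congrArg (· • coordVec e y i) (congrFun ht i)
    have h1 := LinearIndependent.pair_iff.1 hli t (-1) (by rw [this]; module)
    norm_num at h1
  have hD := hG.isOrbitData hK₁ hK₂ hy (fun z hz ↦ sum_bracket_eq_zero he hv.1 hw.1 hc hz)
    (fun z hz A B C D ↦ by
      rw [wedgeForm_swap, wedgeForm_eq_zero (sum_eq_zero_of_antisymz_four (hK₁.killing z hz)
        fun a ↦ (ho e he z hz a).2), neg_zero])
    (fun z hz ↦ wedgeForm_eq_zero (sum_eq_zero_of_antisymz_four (hK₂.killing z hz)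
      fun a ↦ (ho e he z hz a).1)) hvv hli'
  have e₁ := linForm_eq_bilForm hG hK₁ hy
  have e₂ := linForm_eq_bilForm hG hK₂ hy
  have comb {ξ : VField V} (h : ξ = v ∨ ξ = w) :
      ∃ a b : ℝ, upperVec ξ e y = a • upperVec v e y + b • upperVec w e y := by
    rcases h with rfl | rfl
    · exact ⟨1, 0, by simp⟩
    · exact ⟨0, 1, by simp⟩
  -- The current annihilates the orthogonal complement of the two Killing vectors.
  have key {X : Vec} (hX₁ : metricForm (metricComp g e) y (upperVec v e y) X = 0)
      (hX₂ : metricForm (metricComp g e) y (upperVec w e y) X = 0) :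
      ∑ μ, belCurrent g ξ₁ ξ₂ ξ₃ e μ y * X μ = 0 := by
    have z {A B C : Vec} (hA) (hB) (hC) := hD.belForm_eq_zero (A := A) (B := B) (C := C)
      (hG.isCometric hy) hvv hli' hA hB hC hX₁ hX₂
    have c₁ := comb h₁
    have c₂ := comb h₂
    have c₃ := comb h₃
    rw [sum_belCurrent, symBelForm, z c₁ c₂ c₃, z c₁ c₃ c₂, z c₂ c₁ c₃, z c₂ c₃ c₁, z c₃ c₁ c₂,
      z c₃ c₂ c₁]
    ring
  obtain ⟨A, B, hA₁, hA₂, hB₁, hB₂⟩ := exists_dual_pair (hG.isCometric hy) hvv hli'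
  refine ⟨∑ μ, belCurrent g ξ₁ ξ₂ ξ₃ e μ y * A μ, ∑ μ, belCurrent g ξ₁ ξ₂ ξ₃ e μ y * B μ,
    fun μ ↦ ?_⟩
  have := key (X := Pi.single μ 1 - (lowerComp g v e μ y • A + lowerComp g w e μ y • B))
    (by rw [map_sub, map_add, map_smul, map_smul, hA₁, hB₁, ← e₁, linForm_single]; simp)
    (by rw [map_sub, map_add, map_smul, map_smul, hA₂, hB₂, ← e₂, linForm_single]; simp)
  simp only [Pi.sub_apply, Pi.add_apply, Pi.smul_apply, smul_eq_mul, mul_sub, mul_add,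
    Finset.sum_sub_distrib, Finset.sum_add_distrib] at this
  simp only [Pi.single_apply, mul_ite, mul_one, mul_zero, Finset.sum_ite_eq', Finset.mem_univ,
    if_true] at this
  rw [sub_eq_zero.1 this, Finset.sum_mul, Finset.sum_mul]
  congr 1 <;> exact Finset.sum_congr rfl fun i _ ↦ by ring

end Currents

end BelCurrents

end

theorem theorem2 {V : Type*} [TopologicalSpace V] [ChartedSpace BelCurrents.E4 V]
    [IsManifold (𝓡 4) ∞ V] (g : BelCurrents.LorentzMetric V) :
    (∀ ξ : BelCurrents.VField V, BelCurrents.IsKilling g ξ → BelCurrents.IsNonNull g ξ →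
      BelCurrents.IsHypersurfaceOrthogonal g ξ →
      ∀ e ∈ IsManifold.maximalAtlas (𝓡 4) ∞ V, ∀ y ∈ e.target,
        (∀ a : Fin 2 → BelCurrents.Idx,
          BelCurrents.antisymz (fun b : Fin 2 → BelCurrents.Idx ↦
            BelCurrents.belCurrent g ξ ξ ξ e (b 0) y * BelCurrents.lowerComp g ξ e (b 1) y) a = 0) ∧
        ∃ c : ℝ, ∀ μ : BelCurrents.Idx,
          BelCurrents.belCurrent g ξ ξ ξ e μ y = c * BelCurrents.lowerComp g ξ e μ y) ∧
    (∀ ξ η : BelCurrents.VField V, BelCurrents.IsKilling g ξ → BelCurrents.IsKilling g η →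
      BelCurrents.IsNonNull g ξ → BelCurrents.IsNonNull g η →
      LinearIndependent ℝ ![ξ, η] →
      (∀ p : V, VectorField.mlieBracket (𝓡 4) ξ η p = 0) →
      BelCurrents.IsOrthogonallyTransitive g ξ η →
      ∀ L M N : Fin 2, ∀ e ∈ IsManifold.maximalAtlas (𝓡 4) ∞ V, ∀ y ∈ e.target,
        (∀ a : Fin 3 → BelCurrents.Idx,
          BelCurrents.antisymz (fun b : Fin 3 → BelCurrents.Idx ↦
            BelCurrents.belCurrent g (![ξ, η] L) (![ξ, η] M) (![ξ, η] N) e (b 0) y *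
              BelCurrents.lowerComp g ξ e (b 1) y * BelCurrents.lowerComp g η e (b 2) y) a = 0) ∧
        (LinearIndependent ℝ ![ξ (e.symm y), η (e.symm y)] →
          ∃ c d : ℝ, ∀ μ : BelCurrents.Idx,
            BelCurrents.belCurrent g (![ξ, η] L) (![ξ, η] M) (![ξ, η] N) e μ y =
              c * BelCurrents.lowerComp g ξ e μ y + d * BelCurrents.lowerComp g η e μ y)) := by
  refine ⟨fun ξ hξ hn ho e he y hy ↦ ?_, fun ξ η hξ hη hnξ _ _ hc ho L M N e he y hy ↦ ?_⟩
  · obtain ⟨c, hj⟩ := BelCurrents.exists_belCurrent_eq_mul hξ hn ho he hy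
    refine ⟨fun a ↦ ?_, c, hj⟩
    rw [BelCurrents.antisymz_two_eq]
    simp only [hj, Matrix.cons_val]
    ring
  · have hmem (K : Fin 2) : ![ξ, η] K = ξ ∨ ![ξ, η] K = η := by
      fin_cases K <;> simp
    have hj (hli : LinearIndependent ℝ ![ξ (e.symm y), η (e.symm y)]) :=
      BelCurrents.exists_belCurrent_eq_add hξ hη hnξ hc ho he hy hli (hmem L) (hmem M) (hmem N)
    refine ⟨fun a ↦ ?_, hj⟩
    rw [BelCurrents.antisymz_three_eq]
    simp only [Matrix.cons_val]
    by_cases hli : LinearIndependent ℝ ![ξ (e.symm y), η (e.symm y)]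
    · obtain ⟨c, d, hcd⟩ := hj hli
      simp only [hcd]
      ring
    · -- Where the Killing vectors are dependent, already their exterior product vanishes.
      have hdep : ∃ s t : ℝ, s • ξ (e.symm y) + t • η (e.symm y) = 0 ∧ (s ≠ 0 ∨ t ≠ 0) := by
        rw [LinearIndependent.pair_iff] at hli
        push Not at hli
        obtain ⟨s, t, hst, h0⟩ := hli
        exact ⟨s, t, hst, or_iff_not_imp_left.2 fun hs ↦ h0 (not_not.1 hs)⟩
      obtain ⟨s, t, hst, h0⟩ := hdep
      have hl := BelCurrents.lowerComp_comb g hst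
      have hw (i j : BelCurrents.Idx) :
          BelCurrents.lowerComp g ξ e i y * BelCurrents.lowerComp g η e j y
            = BelCurrents.lowerComp g ξ e j y * BelCurrents.lowerComp g η e i y := by
        rcases h0 with h0 | h0 <;> refine mul_left_cancel₀ h0 ?_
        · linear_combination BelCurrents.lowerComp g η e j y * hl i
            - BelCurrents.lowerComp g η e i y * hl j
        · linear_combination BelCurrents.lowerComp g ξ e i y * hl j
            - BelCurrents.lowerComp g ξ e j y * hl i
      simp only [mul_assoc, hw (a 2) (a 1), hw (a 2) (a 0), hw (a 1) (a 0)]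
      ring
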